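/- For $t\in\mathbb{C}$ let $X_t\subset\mathbb{P}^3_{\mathbb{C}}$ be the quintic surface $$F_t(x)=x_0x_1^4+x_1x_2^4+x_2x_0^4+x_3^5+t\,x_3x_1^4=0,$$ let $Z_{1,t}=X_t\cap\{x_3=0\}$ and $Z_{2,t}=X_t\cap\{x_0=0\}$ (both are integral curves), and let $P=(0:1:0:0)$ and $Q=(0:0:1:0)$, which are points of $Z_{1,t}\cap Z_{2,t}$. Let $CH^2(X_t,1)$ be Bloch's higher Chow group, i.e. the first homology group of the complex $(Z^2(X_t,\bullet),\ \partial=\sum_i(-1)^i\partial_i)$, where $Z^2(X_t,n)$ is the free abelian group on the integral closed subschemes of codimension $2$ of $X_t\times\Delta^n$ that meet all faces properly, $\Delta^n=\{T_0+\dots+T_n=1\}$, and $\partial_i$ is the intersection with the face $\{T_i=0\}$. For a nonzero rational function $f$ on an integral curve $Z\subset X_t$ let $Z\otimes f$ be the closure in $X_t\times\Delta^1$ of the graph of $f$, where $\Delta^1\cong\mathbb{P}^1\setminus\{1\}$ via $-T_0/T_1$ (so $Z\otimes 1=0$). Then for every $t\in\mathbb{C}$ the zero-cycles $52P$ and $52Q$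 are rationally equivalent on $Z_{1,t}$, and they are rationally equivalent on $Z_{2,t}$. Moreover there are nonzero rational functions $f_1$ on $Z_{1,t}$ and $f_2$ on $Z_{2,t}$ with $$\operatorname{div}(f_1)=52P-52Q=-\operatorname{div}(f_2)$$ as zero-cycles on $X_t$, such that $Z_{1,t}\otimes f_1+Z_{2,t}\otimes f_2$ lies in $Z^2(X_t,1)$ and has boundary $0$, and hence defines a class $Z_t\in CH^2(X_t,1)$. -/

import Mathlib

noncomputable section

open AlgebraicGeometry CategoryTheory TopologicalSpace

/-! ### Bloch's higher Chow groups -/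

namespace BlochChow

/-- The barycentric coordinates `T₀, …, Tₙ` (with `∑ Tᵢ = 1`) on `X × Δⁿ`. Here `X × Δⁿ` is
realised as the affine space `𝔸ⁿ` over `X` with coordinates `T₁, …, Tₙ`, so that
`T₀ = 1 - T₁ - ⋯ - Tₙ`. -/
def simplexCoord (X : Scheme.{0}) (n : ℕ) (i : Fin (n + 1)) : Γ(𝔸(Fin n; X), ⊤) :=
  Fin.cases (1 - ∑ j : Fin n, AffineSpace.coord X j) (fun j ↦ AffineSpace.coord X j) i

/-- The face `X × Δᵐ ⟶ X × Δⁿ` given by a strictly increasing map `ρ` of vertices: it pulls `T_k`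
back to `T_i` if `k = ρ i`, and to `0` if `k` is not in the image of `ρ`. -/
def faceMap (X : Scheme.{0}) {m n : ℕ} (ρ : Fin (m + 1) ↪o Fin (n + 1)) :
    𝔸(Fin m; X) ⟶ 𝔸(Fin n; X) :=
  AffineSpace.homOfVector (𝔸(Fin m; X) ↘ X)
    (fun j ↦ ∑ i with ρ i = j.succ, simplexCoord X m i)

/-- The `i`-th codimension one face `{Tᵢ = 0}` of `X × Δⁿ⁺¹`. -/
abbrev face (X : Scheme.{0}) (n : ℕ) (i : Fin (n + 2)) : 𝔸(Fin n; X) ⟶ 𝔸(Fin (n + 1); X) :=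
  faceMap X (Fin.succAboveOrderEmb i)

/-- For points `w ⤳ y`, the kernel of `𝒪_{Y,y} → κ(w)`, i.e. the prime ideal of `𝒪_{Y,y}` that
defines the integral closed subscheme `W` with generic point `w`. Hence the local ring
`𝒪_{W,y}` is the quotient of `𝒪_{Y,y}` by this ideal. -/
def primeAt {Y : Scheme.{0}} {w y : Y} (h : w ⤳ y) : Ideal (Y.presheaf.stalk y) :=
  RingHom.ker (Y.presheaf.stalkSpecializes h ≫ Y.residue w).hom

/-- The multiplicity at `y` of the divisor on `W` cut out by the global function `s`, where `W` is
the integral closed subscheme of `Y` with generic point `w`: it is the length of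
`𝒪_{W,y} / (s)` if `y ∈ W`, and `0` otherwise. -/
def intersectionMult {Y : Scheme.{0}} (w : Y) (s : Γ(Y, ⊤)) (y : Y) : ℤ :=
  open Classical in
  if h : w ⤳ y then
    ((Ring.ord (Y.presheaf.stalk y ⧸ primeAt h)
      (Ideal.Quotient.mk (primeAt h) (Y.presheaf.germ ⊤ y trivial s))).toNat : ℤ)
  else 0

/-- The integral closed subscheme of `X × Δⁿ` with generic point `w` has codimension `p`, and it
meets all proper faces `X × Δᵐ` again in codimension (at least) `p`. -/
def IsAdmissible (X : Scheme.{0}) (p n : ℕ) (w : 𝔸(Fin n; X)) : Prop :=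
  Order.coheight w = p ∧
    ∀ m < n, ∀ ρ : Fin (m + 1) ↪o Fin (n + 1), ∀ y : 𝔸(Fin m; X),
      w ⤳ faceMap X ρ y → (p : ℕ∞) ≤ Order.coheight y

/-- The group `Z^p(X, n)` of codimension `p` cycles on `X × Δⁿ` that meet all faces properly. An
integral closed subscheme is represented by its generic point. -/
def chains (X : Scheme.{0}) (p n : ℕ) : AddSubgroup (𝔸(Fin n; X) →₀ ℤ) where
  carrier := {c | ∀ w ∈ c.support, IsAdmissible X p n w}
  zero_mem' := by simp
  add_mem' {a b} ha hb w hw := by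
    classical
    rcases Finset.mem_union.1 (Finsupp.support_add hw) with h | h
    · exact ha w h
    · exact hb w h
  neg_mem' {a} ha w hw := ha w (by simpa using hw)

/-- The differential `∂ = ∑ᵢ (-1)ⁱ ∂ᵢ`, where `∂ᵢ` is the intersection with the face `{Tᵢ = 0}`. The
value is given as the function that attaches to each point `y` of codimension `p` in `X × Δⁿ` the
multiplicity of its closure in `∂ c`, and `0` to all other points. -/
def boundary (X : Scheme.{0}) (p n : ℕ) :
    (𝔸(Fin (n + 1); X) →₀ ℤ) →+ (𝔸(Fin n; X) → ℤ) :=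
  open Classical in
  Finsupp.liftAddHom fun w ↦ zmultiplesHom _ fun y ↦
    if Order.coheight y = p then
      ∑ i : Fin (n + 2),
        (-1) ^ (i : ℕ) * intersectionMult w (simplexCoord X (n + 1) i) (face X n i y)
    else 0

/-- The kernel of the differential `Z^p(X, n) → Z^p(X, n - 1)`. -/
def cycles (X : Scheme.{0}) (p : ℕ) : (n : ℕ) → AddSubgroup (𝔸(Fin n; X) →₀ ℤ)
  | 0 => chains X p 0
  | n + 1 => chains X p (n + 1) ⊓ (boundary X p n).ker

/-- The image of the differential `Z^p(X, n + 1) → Z^p(X, n)`. -/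
def boundaries (X : Scheme.{0}) (p n : ℕ) : AddSubgroup (𝔸(Fin n; X) →₀ ℤ) :=
  ((chains X p (n + 1)).map (boundary X p n)).comap Finsupp.coeFnAddHom

/-- Bloch's higher Chow group `CH^p(X, n)`, the homology of the complex `Z^p(X, •)`. -/
abbrev HigherChow (X : Scheme.{0}) (p n : ℕ) : Type :=
  cycles X p n ⧸ (boundaries X p n).addSubgroupOf (cycles X p n)

/-- The chain `c` is a cycle of the complex `Z^p(X, •)`, and `ζ` is its class in `CH^p(X, n)`. -/
def Represents {X : Scheme.{0}} {p n : ℕ} (c : 𝔸(Fin n; X) →₀ ℤ) (ζ : HigherChow X p n) : Prop :=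
  ∃ h : c ∈ cycles X p n, (QuotientAddGroup.mk ⟨c, h⟩ : HigherChow X p n) = ζ

/-- The generic point of the graph in `X × Δ¹` of the rational function `f ≠ 1` on `Z`, for
`ι : Z ⟶ X`. Here `Δ¹` is identified with `ℙ¹ ∖ {1}` by `f = - T₀ / T₁`, i.e. `T₁ = 1 / (1 - f)`;
zeros of `f` lie over the face `{T₀ = 0}` and poles over the face `{T₁ = 0}`. -/
def graphPoint {Z X : Scheme.{0}} [IsIntegral Z] (ι : Z ⟶ X) (f : Z.functionField) :
    𝔸(Fin 1; X) :=
  AffineSpace.homOfVector (Z.fromSpecStalk (genericPoint Z) ≫ ι)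
    (fun _ ↦ (Scheme.ΓSpecIso Z.functionField).inv (1 / (1 - f)))
    (IsLocalRing.closedPoint Z.functionField)

/-- The chain `Z ⊗ f` on `X × Δ¹`, i.e. the graph of the rational function `f` on `Z`, for a
closed immersion `ι : Z ⟶ X` of an integral scheme. The graph of the constant function `1` does not
meet `X × (ℙ¹ ∖ {1})`. -/
def graph {Z X : Scheme.{0}} [IsIntegral Z] (ι : Z ⟶ X) (f : Z.functionFieldˣ) :
    𝔸(Fin 1; X) →₀ ℤ :=
  open Classical in
  if f = 1 then 0 else Finsupp.single (graphPoint ι f) 1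

end BlochChow

/-! ### Zero-cycles on curves -/

/-- `div f = D` on the integral curve `Z`: the zero-cycle `D` is the divisor of the rational
function `f`. -/
def HasDivisor {Z : Scheme.{0}} [IsIntegral Z] [IsLocallyNoetherian Z] (f : Z.functionFieldˣ)
    (D : Z →₀ ℤ) : Prop :=
  ∀ z : Z, Scheme.ord (f : Z.functionField) z = D z

/-- Rational equivalence of zero-cycles on an integral curve `Z` : equality in `CH₀(Z)`. -/
def RationallyEquivalent {Z : Scheme.{0}} [IsIntegral Z] [IsLocallyNoetherian Z]
    (D D' : Z →₀ ℤ) : Prop :=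
  ∃ f : Z.functionFieldˣ, HasDivisor f (D - D')

/-! ### Projective varieties in `ℙ³` -/

namespace ShiodaQuintic

attribute [local instance] MvPolynomial.gradedAlgebra

/-- The homogeneous coordinate ring of projective 3-space. -/
abbrev S : Type := MvPolynomial (Fin 4) ℂ

/-- Complex projective 3-space. -/
abbrev P3 : Scheme.{0} := Proj (MvPolynomial.homogeneousSubmodule (Fin 4) ℂ)

/-- The closed subset of `ℙ³` where all the polynomials in `s` vanish. -/
def zeroLocus (s : Set S) : Closeds P3 :=
  ⟨ProjectiveSpectrum.zeroLocus (MvPolynomial.homogeneousSubmodule (Fin 4) ℂ) s,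
    ProjectiveSpectrum.isClosed_zeroLocus _ s⟩

/-- The ideal sheaf of all functions vanishing on the zero locus of `s`. -/
def idealSheaf (s : Set S) : P3.IdealSheafData :=
  Scheme.IdealSheafData.vanishingIdeal (zeroLocus s)

/-- The variety `{x ∈ ℙ³ | G(x) = 0 for all G ∈ s}`, as a reduced closed subscheme of `ℙ³`. -/
abbrev variety (s : Set S) : Scheme.{0} := (idealSheaf s).subscheme

theorem idealSheaf_mono {s s' : Set S} (h : s ⊆ s') : idealSheaf s ≤ idealSheaf s' :=
  Scheme.IdealSheafData.vanishingIdeal_antimono (ProjectiveSpectrum.zeroLocus_anti_mono _ h)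

/-- The inclusion of a subvariety. -/
def inclusion {s s' : Set S} (h : s ⊆ s') : variety s' ⟶ variety s :=
  Scheme.IdealSheafData.inclusion (idealSheaf_mono h)

instance : IsLocallyNoetherian P3 := by
  have : IsNoetherianRing (MvPolynomial.homogeneousSubmodule (Fin 4) ℂ 0) := inferInstance
  have : IsScalarTower ℂ (MvPolynomial.homogeneousSubmodule (Fin 4) ℂ 0) S :=
    ⟨fun x y z ↦ smul_mul_assoc x (y : S) z⟩
  have : Algebra.FiniteType (MvPolynomial.homogeneousSubmodule (Fin 4) ℂ 0) S :=
    Algebra.FiniteType.of_restrictScalars_finiteType ℂ _ _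
  exact LocallyOfFiniteType.isLocallyNoetherian
    (Proj.toSpecZero (MvPolynomial.homogeneousSubmodule (Fin 4) ℂ))

instance (s : Set S) : IsLocallyNoetherian (variety s) := by
  change IsLocallyNoetherian (idealSheaf s).subscheme
  have : IsClosedImmersion (idealSheaf s).subschemeι := inferInstance
  have : LocallyOfFiniteType (idealSheaf s).subschemeι := inferInstance
  exact LocallyOfFiniteType.isLocallyNoetherian (idealSheaf s).subschemeι

instance (s : Set S) : IsReduced (variety s) := by
  have : ∀ i, IsReduced ((idealSheaf s).subschemeCover.openCover.X i) := by
    intro U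
    change IsReduced (Spec (.of (Γ(P3, U.1) ⧸ (idealSheaf s).ideal U)))
    rw [affine_isReduced_iff]
    change _root_.IsReduced (Γ(P3, U.1) ⧸ (idealSheaf s).ideal U)
    rw [← Ideal.isRadical_iff_quotient_reduced]
    exact PrimeSpectrum.isRadical_vanishingIdeal _
  exact IsReduced.of_openCover _ (idealSheaf s).subschemeCover.openCover

/-! ### Points of `ℙ³` -/

/-- The homomorphism `G ↦ G(a₀ T, …, a₃ T)`. -/
def evalLine (a : Fin 4 → ℂ) : S →ₐ[ℂ] Polynomial ℂ :=
  MvPolynomial.aeval fun i ↦ Polynomial.C (a i) * Polynomial.X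

theorem evalLine_of_isHomogeneous (a : Fin 4 → ℂ) {G : S} {n : ℕ} (hG : G.IsHomogeneous n) :
    evalLine a G = Polynomial.C (MvPolynomial.eval a G) * Polynomial.X ^ n := by
  rw [evalLine, MvPolynomial.aeval_def, MvPolynomial.eval₂_eq, MvPolynomial.eval_eq, map_sum,
    Finset.sum_mul]
  refine Finset.sum_congr rfl fun d hd ↦ ?_
  have h : ∑ i ∈ d.support, d i = n := by
    rw [← hG (MvPolynomial.mem_support_iff.1 hd), Finsupp.weight_apply]
    simp [Finsupp.sum]
  simp only [mul_pow, Finset.prod_mul_distrib, Finset.prod_pow_eq_pow_sum, h, map_mul, map_prod,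
    map_pow, Polynomial.algebraMap_eq, mul_assoc]

/-- The homogeneous ideal generated by the homogeneous polynomials that vanish at `a`. -/
def pointIdeal (a : Fin 4 → ℂ) :
    HomogeneousIdeal (MvPolynomial.homogeneousSubmodule (Fin 4) ℂ) where
  toSubmodule := RingHom.ker (evalLine a)
  is_homogeneous' := by
    intro n G hG
    have hcomp : ∀ n, (DirectSum.decompose (MvPolynomial.homogeneousSubmodule (Fin 4) ℂ) G n : S) =
        MvPolynomial.homogeneousComponent n G := fun n ↦
      MvPolynomial.decomposition.decompose'_apply G n
    rw [hcomp]
    have hG0 : evalLine a G = 0 := hG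
    change evalLine a _ = 0
    rw [← MvPolynomial.sum_homogeneousComponent G, map_sum] at hG0
    rw [evalLine_of_isHomogeneous a (MvPolynomial.homogeneousComponent_isHomogeneous n G)]
    have hc := congrArg (fun q ↦ Polynomial.coeff q n) hG0
    simp only [evalLine_of_isHomogeneous a (MvPolynomial.homogeneousComponent_isHomogeneous _ G),
      Polynomial.finsetSum_coeff, Polynomial.coeff_C_mul, Polynomial.coeff_X_pow, mul_ite,
      mul_one, mul_zero, Polynomial.coeff_zero, Finset.sum_ite_eq, Finset.mem_range] at hc
    split_ifs at hc with hn
    · rw [hc]; simp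
    · rw [MvPolynomial.homogeneousComponent_eq_zero n G (by omega)]; simp

/-- The point `(a₀ : a₁ : a₂ : a₃)` of `ℙ³`. -/
def point (a : Fin 4 → ℂ) (ha : a ≠ 0) : P3 where
  asHomogeneousIdeal := pointIdeal a
  isPrime := RingHom.ker_isPrime (evalLine a : S →+* Polynomial ℂ)
  not_irrelevant_le := by
    intro h
    refine ha (funext fun i ↦ ?_)
    have hi : (MvPolynomial.X i : S) ∈
        HomogeneousIdeal.irrelevant (MvPolynomial.homogeneousSubmodule (Fin 4) ℂ) := by
      rw [HomogeneousIdeal.mem_irrelevant_iff, GradedRing.proj_apply]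
      exact DirectSum.decompose_of_mem_ne _ (MvPolynomial.isHomogeneous_X ℂ i) one_ne_zero
    have h0 : evalLine a (MvPolynomial.X i) = 0 := h hi
    simpa [evalLine] using h0

/-- The point `(a₀ : a₁ : a₂ : a₃)` of a variety on which it lies. -/
def pointOn {s : Set S} (a : Fin 4 → ℂ) (ha : a ≠ 0) (hs : ∀ G ∈ s, evalLine a G = 0) :
    variety s :=
  (⟨point a ha, by
    change point a ha ∈ ((idealSheaf s).support : Set P3)
    rw [idealSheaf, Scheme.IdealSheafData.coe_support_vanishingIdeal]
    exact hs⟩ : (idealSheaf s).support)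


theorem subschemeι_pointOn {s : Set S} (a : Fin 4 → ℂ) (ha : a ≠ 0)
    (hs : ∀ G ∈ s, evalLine a G = 0) : (idealSheaf s).subschemeι (pointOn a ha hs) = point a ha :=
  rfl

/-! ### Integrality of the curves -/

theorem irreducibleSpace_variety {s : Set S} (hp : (Ideal.span s).IsPrime)
    (hh : (Ideal.span s).IsHomogeneous (MvPolynomial.homogeneousSubmodule (Fin 4) ℂ))
    (hi : ∃ i, (MvPolynomial.X i : S) ∉ Ideal.span s) : IrreducibleSpace (variety s) := by
  let η : P3 := 
    { asHomogeneousIdeal := ⟨Ideal.span s, hh⟩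
      isPrime := hp
      not_irrelevant_le := by
        intro h
        obtain ⟨i, hi⟩ := hi
        refine hi (h ?_)
        change (MvPolynomial.X i : S) ∈
          HomogeneousIdeal.irrelevant (MvPolynomial.homogeneousSubmodule (Fin 4) ℂ)
        rw [HomogeneousIdeal.mem_irrelevant_iff, GradedRing.proj_apply]
        exact DirectSum.decompose_of_mem_ne _ (MvPolynomial.isHomogeneous_X ℂ i) one_ne_zero }
  have hcl : (zeroLocus s : Set P3) = closure {η} := by
    ext x
    refine Iff.trans ?_ (ProjectiveSpectrum.le_iff_mem_closure
      (𝒜 := MvPolynomial.homogeneousSubmodule (Fin 4) ℂ) η x)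
    change s ⊆ _ ↔ Ideal.span s ≤ _
    exact Ideal.span_le.symm
  have hr : Set.range (idealSheaf s).subschemeι = (zeroLocus s : Set P3) := by
    rw [Scheme.IdealSheafData.range_subschemeι, idealSheaf,
      Scheme.IdealSheafData.coe_support_vanishingIdeal]
  obtain ⟨z, hz⟩ : η ∈ Set.range (idealSheaf s).subschemeι := by
    rw [hr, hcl]
    exact subset_closure rfl
  have hd : closure {z} = (Set.univ : Set (idealSheaf s).subscheme) := by
    rw [(idealSheaf s).subschemeι.isEmbedding.isInducing.closure_eq_preimage_closure_image,
      Set.image_singleton, hz, ← hcl, ← hr, Set.preimage_range]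
  change IrreducibleSpace (idealSheaf s).subscheme
  rw [irreducibleSpace_def, Set.top_eq_univ, ← hd]
  exact isIrreducible_singleton.closure

/-- If `φ` is a split surjection with kernel generated by `H`, then `(G, H)` is prime as soon as
`φ G` generates a prime ideal. -/
theorem span_pair_isPrime {R : Type} [CommRing R] (φ : S →+* R) (ψ : R →+* S) (G H : S)
    (hψ : ∀ s, s - ψ (φ s) ∈ Ideal.span {H}) (hH : φ H = 0)
    (hG : (Ideal.span {φ G}).IsPrime) : (Ideal.span {G, H}).IsPrime := by
  have : Ideal.span {G, H} = (Ideal.span {φ G}).comap φ := by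
    apply le_antisymm
    · rw [Ideal.span_le]
      rintro x (rfl | rfl)
      · exact Ideal.mem_span_singleton_self _
      · simp [hH]
    · intro s hs
      obtain ⟨q, hq⟩ := Ideal.mem_span_singleton'.1 (Ideal.mem_comap.1 hs)
      have hle : Ideal.span {H} ≤ Ideal.span {G, H} := Ideal.span_mono (by simp)
      have hGm : G ∈ Ideal.span {G, H} := Ideal.subset_span (by simp)
      have e : s = (s - ψ (φ s)) - ψ q * (G - ψ (φ G)) + ψ q * G := by
        rw [← hq, map_mul]; ring
      rw [e]
      exact add_mem (sub_mem (hle (hψ s)) (Ideal.mul_mem_left _ _ (hle (hψ G))))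
        (Ideal.mul_mem_left _ _ hGm)
  rw [this]
  exact Ideal.IsPrime.comap φ

theorem sub_mem_of_X (φ : S →+* S) (I : Ideal S) (hC : ∀ c, φ (MvPolynomial.C c) = MvPolynomial.C c)
    (h : ∀ i, MvPolynomial.X i - φ (MvPolynomial.X i) ∈ I) (s : S) : s - φ s ∈ I := by
  rw [← Ideal.Quotient.eq]
  have : Ideal.Quotient.mk I = (Ideal.Quotient.mk I).comp φ := by
    refine MvPolynomial.ringHom_ext (fun c ↦ ?_) fun i ↦ ?_
    · simp [hC]
    · exact Ideal.Quotient.eq.2 (h i)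
  exact DFunLike.congr_fun this s

open Polynomial in
theorem span_isPrime_of_eisenstein {R : Type} [CommRing R] [IsDomain R]
    [UniqueFactorizationMonoid R] {a : R} (ha : Prime a) {f : R[X]} (h0 : 0 < f.natDegree)
    (hl : ¬ a ∣ f.leadingCoeff) (hf : ∀ n < f.natDegree, a ∣ f.coeff n)
    (h2 : ¬ a ^ 2 ∣ f.coeff 0) (hu : f.IsPrimitive) : (Ideal.span {f}).IsPrime := by
  have hf0 : f ≠ 0 := by rintro rfl; simp at h0
  rw [Ideal.span_singleton_prime hf0, ← UniqueFactorizationMonoid.irreducible_iff_prime]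
  refine irreducible_of_eisenstein_criterion (P := Ideal.span {a})
    ((Ideal.span_singleton_prime ha.ne_zero).2 ha) ?_ ?_ (natDegree_pos_iff_degree_pos.1 h0) ?_ hu
  · rwa [Ideal.mem_span_singleton]
  · intro n hn
    rw [Ideal.mem_span_singleton]
    exact hf n (coe_lt_degree.1 hn)
  · rwa [Ideal.span_singleton_pow, Ideal.mem_span_singleton]

section Equations

open MvPolynomial

/-- The quintic form `F_t = x₀x₁⁴ + x₁x₂⁴ + x₂x₀⁴ + x₃⁵ + t x₃x₁⁴`. -/
def F (t : ℂ) : S :=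
  X 0 * X 1 ^ 4 + X 1 * X 2 ^ 4 + X 2 * X 0 ^ 4 + X 3 ^ 5 + C t * X 3 * X 1 ^ 4

theorem F_isHomogeneous (t : ℂ) : (F t).IsHomogeneous 5 := by
  have h (i : Fin 4) (n : ℕ) : (X i ^ n : S).IsHomogeneous n := by
    simpa using (isHomogeneous_X ℂ i).pow n
  have h1 (i j : Fin 4) : (X i * X j ^ 4 : S).IsHomogeneous 5 :=
    (isHomogeneous_X ℂ i).mul (h j 4)
  refine ((((h1 0 1).add (h1 1 2)).add (h1 2 0)).add (h 3 5)).add ?_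
  rw [mul_assoc]
  simpa using (isHomogeneous_C (Fin 4) t).mul (h1 3 1)

/-- The polynomial ring in `x₁, x₂`. -/
abbrev A : Type := MvPolynomial (Fin 2) ℂ

theorem not_dvd_X : ¬ (X 0 : A) ∣ X 1 := by
  intro h
  have := map_dvd (eval (![0, 1] : Fin 2 → ℂ)) h
  simp at this

theorem not_sq_dvd : ¬ (X 0 : A) ^ 2 ∣ X 0 * X 1 ^ 4 := by
  intro h
  rw [pow_two] at h
  exact not_dvd_X (X_prime.dvd_of_dvd_pow ((mul_dvd_mul_iff_left X_prime.ne_zero).1 h))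

theorem prime_Z₁ (t : ℂ) : (Ideal.span {F t, X 3}).IsPrime := by
  let φ : S →+* Polynomial A := (aeval (R := ℂ)
    ![Polynomial.X, Polynomial.C (X 0), Polynomial.C (X 1), 0]).toRingHom
  let ψ : Polynomial A →+* S := Polynomial.eval₂RingHom
    (aeval (R := ℂ) (![X 1, X 2] : Fin 2 → S)).toRingHom (X 0)
  have hφ : φ (F t) = Polynomial.C (X 1) * Polynomial.X ^ 4 + Polynomial.C (X 0 ^ 4) * Polynomial.X +
      Polynomial.C (X 0 * X 1 ^ 4) := by
    simp [φ, F]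
    ring
  refine span_pair_isPrime φ ψ _ _ (sub_mem_of_X (ψ.comp φ) _ (fun c ↦ ?_) fun i ↦ ?_) ?_ ?_
  · simp [φ, ψ]
  · fin_cases i <;> simp [φ, ψ]
  · simp [φ]
  · generalize φ (F t) = f at hφ ⊢
    have hb : (X 1 : A) ≠ 0 := X_ne_zero 1
    have hn : f.natDegree = 4 := by rw [hφ]; compute_degree!
    have c4 : f.coeff 4 = X 1 := by
      simp [hφ, -map_pow, -map_mul]
    have c0 : f.coeff 0 = X 0 * X 1 ^ 4 := by simp [hφ, -map_mul, -map_pow]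
    have c1 : f.coeff 1 = X 0 ^ 4 := by
      simp [hφ, Polynomial.coeff_X_pow, Polynomial.coeff_C, -map_pow, -map_mul]
    have c2 : f.coeff 2 = 0 := by
      simp [hφ, Polynomial.coeff_X_pow, -map_pow, -map_mul]
    have c3 : f.coeff 3 = 0 := by
      simp [hφ, Polynomial.coeff_X_pow, -map_pow, -map_mul]
    refine span_isPrime_of_eisenstein (X_prime (i := 0)) (by omega) ?_ ?_ ?_ ?_
    · rw [Polynomial.leadingCoeff, hn, c4]
      exact not_dvd_X
    · rw [hn]
      intro n hn
      interval_cases n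
      · simp [c0]
      · rw [c1]; exact dvd_pow_self _ (by norm_num)
      · simp [c2]
      · simp [c3]
    · rw [c0]; exact not_sq_dvd
    · intro r hr
      rw [Polynomial.C_dvd_iff_dvd_coeff] at hr
      have h4 := hr 4
      have h1 := hr 1
      rw [c4] at h4
      rw [c1] at h1
      refine ((X_prime (R := ℂ) (i := (1 : Fin 2))).irreducible.dvd_iff.1 h4).resolve_right ?_
      intro has
      have h := (X_prime (R := ℂ) (i := (1 : Fin 2))).dvd_of_dvd_pow (has.dvd.trans h1)
      have := map_dvd (eval (![1, 0] : Fin 2 → ℂ)) h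
      simp at this

theorem prime_Z₂ (t : ℂ) : (Ideal.span {F t, X 0}).IsPrime := by
  let φ : S →+* Polynomial A := (aeval (R := ℂ)
    ![0, Polynomial.C (X 0), Polynomial.C (X 1), Polynomial.X]).toRingHom
  let ψ : Polynomial A →+* S := Polynomial.eval₂RingHom
    (aeval (R := ℂ) (![X 1, X 2] : Fin 2 → S)).toRingHom (X 3)
  have hφ : φ (F t) = Polynomial.X ^ 5 + Polynomial.C (C t * X 0 ^ 4) * Polynomial.X +
      Polynomial.C (X 0 * X 1 ^ 4) := by
    simp [φ, F]
    ring
  refine span_pair_isPrime φ ψ _ _ (sub_mem_of_X (ψ.comp φ) _ (fun c ↦ ?_) fun i ↦ ?_) ?_ ?_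
  · simp [φ, ψ]
  · fin_cases i <;> simp [φ, ψ]
  · simp [φ]
  · generalize φ (F t) = f at hφ ⊢
    have hn : f.natDegree = 5 := by rw [hφ]; compute_degree!
    have c5 : f.coeff 5 = 1 := by
      simp [hφ, -map_pow, -map_mul]
    have c0 : f.coeff 0 = X 0 * X 1 ^ 4 := by simp [hφ, -map_mul, -map_pow]
    have hm : f.Monic := by rw [Polynomial.Monic, Polynomial.leadingCoeff, hn, c5]
    refine span_isPrime_of_eisenstein (X_prime (i := 0)) (by omega) ?_ ?_ ?_ hm.isPrimitive
    · rw [hm.leadingCoeff]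
      exact fun h ↦ (X_prime (R := ℂ) (i := (0 : Fin 2))).not_dvd_one h
    · rw [hn]
      intro n hn
      interval_cases n
      · simp [c0]
      all_goals
        simp [hφ, Polynomial.coeff_X_pow, Polynomial.coeff_C, -map_pow, -map_mul]
      exact Dvd.dvd.mul_left (dvd_pow_self _ (by norm_num)) _
    · rw [c0]; exact not_sq_dvd

/-- The quintic surface `X_t = {F_t = 0}`. -/
abbrev surface (t : ℂ) : Scheme.{0} := variety {F t}

/-- The curve `Z_{1,t} = X_t ∩ {x₃ = 0}`. -/
abbrev Z₁ (t : ℂ) : Scheme.{0} := variety {F t, X 3}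

/-- The curve `Z_{2,t} = X_t ∩ {x₀ = 0}`. -/
abbrev Z₂ (t : ℂ) : Scheme.{0} := variety {F t, X 0}

/-- The inclusion of `Z_{1,t}` into `X_t`. -/
def ι₁ (t : ℂ) : Z₁ t ⟶ surface t := inclusion (by simp)

/-- The inclusion of `Z_{2,t}` into `X_t`. -/
def ι₂ (t : ℂ) : Z₂ t ⟶ surface t := inclusion (by simp)

/-- `P = (0 : 1 : 0 : 0)`, as a point of any variety that contains it. -/
def P {s : Set S} (hs : ∀ G ∈ s, evalLine ![0, 1, 0, 0] G = 0) : variety s :=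
  pointOn ![0, 1, 0, 0] (fun h ↦ by simpa using congrFun h 1) hs

/-- `Q = (0 : 0 : 1 : 0)`, as a point of any variety that contains it. -/
def Q {s : Set S} (hs : ∀ G ∈ s, evalLine ![0, 0, 1, 0] G = 0) : variety s :=
  pointOn ![0, 0, 1, 0] (fun h ↦ by simpa using congrFun h 2) hs

/-- The point `P` of `X_t`. -/
def PX (t : ℂ) : surface t := P (by simp [evalLine, F])

/-- The point `Q` of `X_t`. -/
def QX (t : ℂ) : surface t := Q (by simp [evalLine, F])

/-- The point `P` of `Z_{1,t}`. -/
def P₁ (t : ℂ) : Z₁ t := P (by simp [evalLine, F])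

/-- The point `Q` of `Z_{1,t}`. -/
def Q₁ (t : ℂ) : Z₁ t := Q (by simp [evalLine, F])

/-- The point `P` of `Z_{2,t}`. -/
def P₂ (t : ℂ) : Z₂ t := P (by simp [evalLine, F])

/-- The point `Q` of `Z_{2,t}`. -/
def Q₂ (t : ℂ) : Z₂ t := Q (by simp [evalLine, F])

theorem X_one_notMem {t : ℂ} {i : Fin 4} (hi : i ≠ 1) : (X 1 : S) ∉ Ideal.span {F t, X i} := by
  intro h
  have hle : Ideal.span {F t, X i} ≤ RingHom.ker (eval (Pi.single 1 1 : Fin 4 → ℂ)) := by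
    rw [Ideal.span_le]
    rintro G (rfl | rfl)
    · simp [F]
    · simp [hi]
  simpa using hle h

theorem span_isHomogeneous (t : ℂ) (i : Fin 4) :
    (Ideal.span {F t, X i}).IsHomogeneous (homogeneousSubmodule (Fin 4) ℂ) := by
  refine Ideal.homogeneous_span _ _ ?_
  rintro G (rfl | rfl)
  · exact ⟨5, F_isHomogeneous t⟩
  · exact ⟨1, isHomogeneous_X ℂ i⟩

instance (t : ℂ) : IsIntegral (Z₁ t) := by
  have := irreducibleSpace_variety (prime_Z₁ t) (span_isHomogeneous t 3)
    ⟨1, X_one_notMem (by decide)⟩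
  exact isIntegral_of_irreducibleSpace_of_isReduced _

instance (t : ℂ) : IsIntegral (Z₂ t) := by
  have := irreducibleSpace_variety (prime_Z₂ t) (span_isHomogeneous t 0)
    ⟨1, X_one_notMem (by decide)⟩
  exact isIntegral_of_irreducibleSpace_of_isReduced _

end Equations

end ShiodaQuintic

end

open BlochChow ShiodaQuintic

noncomputable section

open AlgebraicGeometry CategoryTheory TopologicalSpace

/-! ### Lengths and orders of vanishing in local rings -/

namespace Ring

/-! The functions are powers of monomials in the coordinates. On `Z₁ t`, where x₃ = 0, take g₁ =
x₀³x₂/x₁⁴. At P the function x₂/x₁ is a uniformizer and x₀/x₁ is its fourth power up to a unit, so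
g₁ has order 3·4 + 1 = 13. At Q the function x₀/x₂ is a uniformizer and x₁/x₂ is its fourth power up
to a unit, so the order is 3 - 16 = -13. At (1:0:0:0) the function x₂/x₀ is (x₁/x₀)⁴ up to a unit
and g₁ is invertible. No other point matters, since the equation lets a coordinate vanish only at
these three points. On `Z₂ t`, where x₀ = 0, the function g₂ = x₃/x₁ has divisor 4P - 4Q. Hence g₁⁴
and g₂¹³ both have divisor 52P - 52Q, and f₁ = g₁⁴, f₂ = g₂⁻¹³ answer the question
(`hasZeroPole_of_X_three_mem`, `hasZeroPole_of_X_zero_mem`).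

The delicate local computation is the order of x₃/x₁ at P on `Z₂ t`, which is a singular point when
t = 0. There the order is the length of a quotient; `Ring.ord_eq_four` bounds it by 4 from above and
lets additivity of the order, applied to the equation of the curve, exclude smaller values.

The boundary of Z ⊗ f is div f pushed forward to X (`HasZeroPole.boundary_graph`). On the graph T₁ =
1/(1 - f) and T₀ = -f/(1 - f). If f or 1/f lies in the maximal ideal at z, these are regular at z,
the local ring of the graph over z is 𝒪_{Z,z}, and the multiplicity along a face is the order of Tᵢ
there, that is, of f or of 1/f. If f is a unit at z, the inverses 1/T₁ = 1 - f and 1/T₀ = 1 - 1/f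
are regular, and the graph misses both faces over z, even where f takes the value 1. Since the two
divisors are opposite on X, the boundaries cancel. That the graphs are admissible is a count of
codimensions. -/

theorem ord_ringEquiv {R R' : Type*} [CommRing R] [CommRing R'] (e : R ≃+* R') (x : R) :
    Ring.ord R' (e x) = Ring.ord R x := by
  have hI : Ideal.span {e x} = (Ideal.span {x}).map (e : R →+* R') := by
    rw [Ideal.map_span, Set.image_singleton]; rfl
  let q := Ideal.quotientEquiv (Ideal.span {x}) (Ideal.span {e x}) e hI
  let _ : RingHomInvPair (e : R →+* R') (e.symm : R' →+* R) := RingHomInvPair.of_ringEquiv e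
  let _ : RingHomInvPair (e.symm : R' →+* R) (e : R →+* R') := RingHomInvPair.of_ringEquiv e.symm
  let l : (R ⧸ Ideal.span {x}) ≃ₛₗ[(e : R →+* R')] (R' ⧸ Ideal.span {e x}) :=
    { q with
      map_smul' := by
        intro r m
        obtain ⟨m, rfl⟩ := Ideal.Quotient.mk_surjective m
        change Ideal.Quotient.mk _ (e (r * m)) = Ideal.Quotient.mk _ (e r * e m)
        rw [map_mul] }
  -- The two lengths are over different rings; each is the Krull dimension of a lattice of
  -- submodules, and the semilinear equivalence `l` identifies the lattices.
  unfold Ring.ord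
  apply WithBot.coe_injective
  rw [Module.coe_length, Module.coe_length,
    Order.krullDim_eq_of_orderIso (Submodule.orderIsoMapComap l)]

section LocalRing

variable {R : Type*} [CommRing R] [IsLocalRing R]

theorem length_quotient_maximalIdeal :
    Module.length R (R ⧸ IsLocalRing.maximalIdeal R) = 1 := by
  rw [Module.length_eq_one_iff]
  exact isSimpleModule_iff_quot_maximal.2 ⟨_, inferInstance, ⟨LinearEquiv.refl _ _⟩⟩

theorem ord_eq_one_of_maximalIdeal {x : R} (h : IsLocalRing.maximalIdeal R = Ideal.span {x}) :
    Ring.ord R x = 1 := by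
  rw [Ring.ord, ← h, length_quotient_maximalIdeal]

theorem one_le_ord {x : R} (h : ¬ IsUnit x) : 1 ≤ Ring.ord R x := by
  rw [← length_quotient_maximalIdeal (R := R), Ring.ord]
  have hle : Ideal.span {x} ≤ IsLocalRing.maximalIdeal R := by
    rw [Ideal.span_singleton_le_iff_mem]; exact h
  exact Module.length_le_of_surjective (Submodule.factor hle) (Submodule.factor_surjective hle)

/-- Induction along the exact sequence R/(y, x) → R/(y, xⁿ⁺¹) → R/(y, xⁿ) → 0, whose first map is
multiplication by xⁿ and whose first term has length at most 1. -/
theorem length_quotient_span_pair_pow_le {x y : R}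
    (h : IsLocalRing.maximalIdeal R ≤ Ideal.span {y, x}) (n : ℕ) :
    Module.length R (R ⧸ Ideal.span {y, x ^ n}) ≤ n := by
  induction n with
  | zero =>
    have : Ideal.span {y, x ^ 0} = ⊤ := by
      rw [Ideal.eq_top_iff_one]; exact Ideal.subset_span (by simp)
    rw [this]
    simp
  | succ n ih =>
    have hle : Ideal.span {y, x ^ (n + 1)} ≤ Ideal.span {y, x ^ n} := by
      rw [Ideal.span_le]
      rintro z (hz | hz)
      · exact Ideal.subset_span (by simp [hz])
      · rw [show z = x ^ (n + 1) from hz, pow_succ']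
        exact Ideal.mul_mem_left _ _ (Ideal.subset_span (by simp))
    let φ : (R ⧸ Ideal.span {y, x}) →ₗ[R] (R ⧸ Ideal.span {y, x ^ (n + 1)}) :=
      Submodule.mapQ _ _ (LinearMap.mul R R (x ^ n)) (by
        change Ideal.span {y, x} ≤ _
        rw [Ideal.span_le]
        rintro z (hz | hz)
        · exact Ideal.mul_mem_left _ _ (Ideal.subset_span (by simp [hz]))
        · change x ^ n * z ∈ Ideal.span {y, x ^ (n + 1)}
          rw [show z = x from hz]
          rw [← pow_succ]
          exact Ideal.subset_span (by simp))
    have hψ := Submodule.factor_surjective hle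
    have hex : Function.Exact φ (Submodule.factor hle) := by
      intro z
      obtain ⟨z, rfl⟩ := Ideal.Quotient.mk_surjective z
      constructor
      · intro hz
        have hz' : z ∈ Ideal.span {y, x ^ n} := Ideal.Quotient.eq_zero_iff_mem.1 hz
        obtain ⟨a, b, rfl⟩ := Ideal.mem_span_pair.1 hz'
        refine ⟨Ideal.Quotient.mk _ b, ?_⟩
        change Ideal.Quotient.mk _ (x ^ n * b) = Ideal.Quotient.mk _ _
        rw [Ideal.Quotient.eq]
        have : x ^ n * b - (a * y + b * x ^ n) = (-a) * y := by ring
        rw [this]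
        exact Ideal.mul_mem_left _ _ (Ideal.subset_span (by simp))
      · rintro ⟨b, hb⟩
        obtain ⟨b, rfl⟩ := Ideal.Quotient.mk_surjective b
        rw [← hb]
        change Ideal.Quotient.mk _ (x ^ n * b) = 0
        rw [Ideal.Quotient.eq_zero_iff_mem, mul_comm]
        exact Ideal.mul_mem_left _ _ (Ideal.subset_span (by simp))
    have h1 : Module.length R (LinearMap.range φ) ≤ 1 := by
      refine (Module.length_le_of_surjective φ.rangeRestrict φ.surjective_rangeRestrict).trans ?_
      rw [← length_quotient_maximalIdeal (R := R)]
      exact Module.length_le_of_surjective (Submodule.factor h) (Submodule.factor_surjective h)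
    have hex' : Function.Exact (LinearMap.range φ).subtype (Submodule.factor hle) := by
      intro z
      rw [hex z]
      simp
    rw [Module.length_eq_add_of_exact _ _ (Submodule.subtype_injective _) hψ hex', add_comm]
    push_cast
    gcongr

/-- The order of `y` at a (possibly singular) point of the plane curve
`x⁴ + y (t + y⁴) = 0` at the origin. -/
theorem ord_eq_four [IsDomain R] {x y t : R} (hm : IsLocalRing.maximalIdeal R = Ideal.span {y, x})
    (hy : y ≠ 0) (hx : x ≠ 0) (h : x ^ 4 = -(y * (t + y ^ 4))) (ht : t = 0 ∨ IsUnit t) :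
    Ring.ord R y = 4 := by
  have hymem : y ∈ IsLocalRing.maximalIdeal R := by rw [hm]; exact Ideal.subset_span (by simp)
  have hxmem : x ∈ IsLocalRing.maximalIdeal R := by rw [hm]; exact Ideal.subset_span (by simp)
  have h1 : 1 ≤ Ring.ord R y := one_le_ord hymem
  have h1' : 1 ≤ Ring.ord R x := one_le_ord hxmem
  -- By the equation x⁴ is a multiple of y, so R/(y) = R/(y, x⁴).
  have h4 : Ring.ord R y ≤ 4 := by
    have := length_quotient_span_pair_pow_le hm.le 4
    have hs : Ideal.span {y, x ^ 4} = Ideal.span {y} := by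
      apply le_antisymm
      · rw [Ideal.span_le]
        rintro z (rfl | rfl)
        · exact Ideal.mem_span_singleton_self _
        · rw [h, ← mul_neg]
          exact Ideal.mul_mem_right _ _ (Ideal.mem_span_singleton_self _)
      · exact Ideal.span_mono (by simp)
    rw [hs] at this
    exact_mod_cast this
  have hx4 : Ring.ord R (x ^ 4) = 4 • Ring.ord R x :=
    Ring.ord_pow (mem_nonZeroDivisors_of_ne_zero hx) 4
  rw [h, Ring.ord_neg] at hx4
  obtain ⟨k, hk⟩ := ENat.ne_top_iff_exists.1 (ne_top_of_le_ne_top (by decide) h4)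
  -- For t = 0 the equation gives 4 ord x = 5 ord y, so 4 divides ord y, which lies between 1 and 4.
  -- For t a unit it gives 4 ord x = ord y ≤ 4 with ord x ≥ 1.
  rcases ht with rfl | ht
  · rw [zero_add, ← pow_succ', Ring.ord_pow (mem_nonZeroDivisors_of_ne_zero hy)] at hx4
    rw [← hk] at h1 h4 hx4 ⊢
    have : Ring.ord R x ≠ ⊤ := by
      intro ht; rw [ht] at hx4; simp at hx4
      exact absurd hx4 (ENat.natCast_ne_top (5 * k))
    obtain ⟨l, hl⟩ := ENat.ne_top_iff_exists.1 this
    rw [← hl] at h1' hx4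
    simp only [nsmul_eq_mul] at hx4
    norm_cast at *
    omega
  · have hu : IsUnit (t + y ^ 4) := by
      by_contra hn
      have : t + y ^ 4 - y ^ 4 ∈ IsLocalRing.maximalIdeal R :=
        sub_mem hn (Ideal.pow_mem_of_mem _ hymem 4 (by norm_num))
      rw [add_sub_cancel_right] at this
      exact this ht
    rw [Ring.ord_mul_of_isUnit_right hu] at hx4
    rw [← hk] at h1 h4 hx4 ⊢
    have : Ring.ord R x ≠ ⊤ := by
      intro ht; rw [ht] at hx4; simp at hx4
    obtain ⟨l, hl⟩ := ENat.ne_top_iff_exists.1 this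
    rw [← hl] at h1' hx4
    simp only [nsmul_eq_mul] at hx4
    norm_cast at *
    omega

end LocalRing

end Ring

/-! ### Codimension of points, measured by `Order.coheight` -/

namespace AlgebraicGeometry

/-- A chain of generizations in A maps to one in B that avoids the generic point, because the image
is closed and proper; the generic point therefore prolongs it by one step. -/
theorem coheight_add_one_le_of_isClosedImmersion {A B : Scheme.{0}} (i : A ⟶ B)
    [IsClosedImmersion i] [IrreducibleSpace B] {b : B} (hb : b ∉ Set.range i) (a : A) :
    Order.coheight a + 1 ≤ Order.coheight (i a) := by
  have hsp {x y : A} : x ⤳ y ↔ i x ⤳ i y := (i.isClosedEmbedding.isInducing.specializes_iff).symm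
  have hlt {x y : A} : x < y ↔ i x < i y := by
    simp only [lt_iff_le_not_ge]
    change (y ⤳ x ∧ ¬ x ⤳ y) ↔ (i y ⤳ i x ∧ ¬ i x ⤳ i y)
    rw [hsp, hsp]
  have hgen (x : A) : i x < genericPoint B := by
    rw [lt_iff_le_not_ge]
    refine ⟨genericPoint_specializes _, fun h : i x ⤳ genericPoint B ↦ hb ?_⟩
    have h1 : i x ⤳ b := h.trans (genericPoint_specializes b)
    exact h1.mem_closed i.isClosedEmbedding.isClosed_range ⟨x, rfl⟩
  have key (p : LTSeries A) : (p.length : ℕ∞) + 1 ≤ Order.coheight (i p.head) := by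
    let q : LTSeries B := (p.map i (fun _ _ h ↦ hlt.1 h)).snoc (genericPoint B) (hgen _)
    have := Order.length_le_coheight_head (p := q)
    have hq : q.head = i p.head := RelSeries.head_snoc _ _ _
    have hl : q.length = p.length + 1 := rfl
    rw [hq, hl] at this
    exact_mod_cast this
  by_cases htop : Order.coheight (i a) = ⊤
  · rw [htop]; exact le_top
  obtain ⟨n, hn⟩ := ENat.ne_top_iff_exists.1 htop
  have hfin : Order.coheight a ≠ ⊤ := by
    intro ht
    obtain ⟨p, hp, hl⟩ := (Order.coheight_eq_top_iff).1 ht n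
    have := key p
    rw [hp, hl, ← hn] at this
    norm_cast at this
    omega
  obtain ⟨p, hp, hl⟩ := Order.exists_series_of_coheight_eq_coe a (ENat.natCast_toNat hfin).symm
  have := key p
  rw [hp, hl, ENat.natCast_toNat hfin] at this
  exact this

theorem one_le_coheight {Z : Scheme.{0}} [IrreducibleSpace Z] {x : Z} (hx : x ≠ genericPoint Z) :
    1 ≤ Order.coheight x := by
  refine le_trans (by simp) (Order.coheight_add_one_le (b := x) (a := genericPoint Z) ?_)
  rw [lt_iff_le_not_ge]
  refine ⟨genericPoint_specializes _, fun h : x ⤳ genericPoint Z ↦ hx ?_⟩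
  exact (h.antisymm (genericPoint_specializes x)).eq

instance {Z X : Scheme.{0}} (ι : Z ⟶ X) [IsClosedImmersion ι] (n : Type) :
    IsClosedImmersion (AffineSpace.map n ι) :=
  MorphismProperty.of_isPullback (AffineSpace.isPullback_map ι).flip inferInstance

theorem exists_notMem_range_map {Z X : Scheme.{0}} (ι : Z ⟶ X) (n : Type) {x : X}
    (hx : x ∉ Set.range ι) : ∃ y : 𝔸(n; X), y ∉ Set.range (AffineSpace.map n ι) := by
  obtain ⟨y, hy⟩ := (𝔸(n; X) ↘ X).surjective x
  refine ⟨y, ?_⟩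
  rintro ⟨z, rfl⟩
  refine hx ⟨(𝔸(n; Z) ↘ Z) z, ?_⟩
  rw [← hy, ← Scheme.Hom.comp_apply, ← Scheme.Hom.comp_apply, AffineSpace.map_over]

theorem coheight_le_of_openCover {X : Scheme.{0}} {n : ℕ∞} {x : X} {R : CommRingCat.{0}}
    (f : Spec R ⟶ X) [IsOpenImmersion f] (hx : x ∈ Set.range f) (h : ringKrullDim R ≤ n) :
    Order.coheight x ≤ n := by
  obtain ⟨y, rfl⟩ := hx
  have := coheight_eq_of_isOpenImmersion f (x := y)
  rw [show f y = f.base y from rfl, this, ← idealHeight_eq_coheight]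
  have h2 : (y.asIdeal.height : WithBot ℕ∞) ≤ ringKrullDim R :=
    Ideal.height_le_ringKrullDim_of_ne_top y.2.ne_top
  exact_mod_cast h2.trans h

theorem coheight_affineSpace_le {X : Scheme.{0}} {R : CommRingCat.{0}} [IsNoetherianRing R]
    (f : Spec R ⟶ X) [IsOpenImmersion f] {m : ℕ} {n : ℕ}
    (h : ringKrullDim R ≤ n) (y : 𝔸(Fin m; X)) (hx : (𝔸(Fin m; X) ↘ X) y ∈ Set.range f) :
    Order.coheight y ≤ n + m := by
  have hp := AffineSpace.isPullback_map (n := Fin m) f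
  have : IsOpenImmersion (AffineSpace.map (Fin m) f) :=
    MorphismProperty.of_isPullback hp.flip inferInstance
  refine coheight_le_of_openCover ((AffineSpace.SpecIso (Fin m) R).inv ≫ AffineSpace.map (Fin m) f)
    ?_ ?_
  · have hr : y ∈ Set.range (AffineSpace.map (Fin m) f) := by
      obtain ⟨s, hs⟩ := hx
      obtain ⟨z, hz, -⟩ := Scheme.exists_preimage_of_isPullback hp y s hs.symm
      exact ⟨z, hz⟩
    obtain ⟨z, rfl⟩ := hr
    refine ⟨(AffineSpace.SpecIso (Fin m) R).hom z, ?_⟩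
    rw [← Scheme.Hom.comp_apply, Iso.hom_inv_id_assoc]
  · change ringKrullDim (MvPolynomial (Fin m) R) ≤ _
    rw [MvPolynomial.ringKrullDim_of_isNoetherianRing]
    simp only [Nat.card_eq_fintype_card, Fintype.card_fin]
    push_cast
    gcongr

end AlgebraicGeometry

/-! ### Morphisms from spectra of local rings and their maps on stalks -/

namespace AlgebraicGeometry.Scheme

theorem stalkClosedPointTo_germ_top {Y : Scheme.{0}} {R : CommRingCat.{0}} [IsLocalRing R]
    (f : Spec R ⟶ Y) (s : Γ(Y, ⊤)) :
    stalkClosedPointTo f (Y.presheaf.germ ⊤ (f (IsLocalRing.closedPoint R)) trivial s) =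
      (ΓSpecIso R).hom (f.appTop s) := by
  have := germ_stalkClosedPointTo f ⊤ trivial
  refine (ConcreteCategory.congr_hom this s).trans ?_
  simp only [Iso.trans_hom, Functor.mapIso_hom, Iso.op_hom, eqToIso.hom]
  change (ΓSpecIso R).hom ((Spec R).presheaf.map (𝟙 _) (f.appTop s)) = _
  rw [CategoryTheory.Functor.map_id]
  rfl

theorem stalkSpecializes_stalkClosedPointTo {Y : Scheme.{0}} {R R' : CommRingCat.{0}}
    [IsLocalRing R] [IsLocalRing R'] (φ : R ⟶ R') (G : Spec R ⟶ Y) (g : Spec R' ⟶ Y)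
    (hg : Spec.map φ ≫ G = g)
    (h : g (IsLocalRing.closedPoint R') ⤳ G (IsLocalRing.closedPoint R)) :
    Y.presheaf.stalkSpecializes h ≫ stalkClosedPointTo g = stalkClosedPointTo G ≫ φ := by
  apply Spec.map_injective
  rw [← cancel_mono (Y.fromSpecStalk _)]
  simp only [Spec.map_comp, Category.assoc, SpecMap_stalkSpecializes_fromSpecStalk,
    Spec_stalkClosedPointTo_fromSpecStalk, hg]

theorem stalkClosedPointTo_fromSpecStalk_germ {Y : Scheme.{0}} (y : Y) (U : Y.Opens)
    (hy : y ∈ U) (hU) (s : Γ(Y, U)) :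
    stalkClosedPointTo (Y.fromSpecStalk y) (Y.presheaf.germ U _ hU s) =
      Y.presheaf.germ U y hy s := by
  rw [stalkClosedPointTo_fromSpecStalk, TopCat.Presheaf.stalkCongr_hom]
  exact TopCat.Presheaf.germ_stalkSpecializes_apply _ _ _ _

theorem stalkClosedPointTo_fromSpecStalk_comp_surjective {Z X : Scheme.{0}} (ι : Z ⟶ X)
    [IsClosedImmersion ι] (z : Z) (g : Spec (Z.presheaf.stalk z) ⟶ X)
    (hg : g = Z.fromSpecStalk z ≫ ι) : Function.Surjective (stalkClosedPointTo g) := by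
  subst hg
  rw [stalkClosedPointTo_comp, stalkClosedPointTo_fromSpecStalk]
  have h1 := (ConcreteCategory.bijective_of_isIso (Z.presheaf.stalkCongr
    (show Inseparable (Z.fromSpecStalk z (IsLocalRing.closedPoint _)) z by
      rw [fromSpecStalk_closedPoint])).hom).2
  exact h1.comp (ι.stalkMap_surjective _)

theorem stalkClosedPointTo_fromSpecStalk_comp_germ {Z X : Scheme.{0}} (ι : Z ⟶ X)
    (z : Z) (g : Spec (Z.presheaf.stalk z) ⟶ X)
    (hg : g = Z.fromSpecStalk z ≫ ι) (U : X.Opens) (hz : ι z ∈ U) (hU) (s : Γ(X, U)) :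
    stalkClosedPointTo g (X.presheaf.germ U _ hU s) =
      Z.presheaf.germ (ι ⁻¹ᵁ U) z hz (ι.app U s) := by
  subst hg
  rw [stalkClosedPointTo_comp]
  change stalkClosedPointTo (Z.fromSpecStalk z) (ι.stalkMap _ _) = _
  refine Eq.trans (congrArg _ (ι.germ_stalkMap_apply U _ hU s)) ?_
  exact stalkClosedPointTo_fromSpecStalk_germ _ _ _ _ _

end AlgebraicGeometry.Scheme

/-! ### The graph of a rational function near the two faces -/

namespace BlochChow

variable {Z X : Scheme.{0}}

/-- The morphism `Spec 𝒪_{Z,z} ⟶ X × Δ¹` over `ι` on which `T₁` takes the value `a`. -/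
def stalkHom (ι : Z ⟶ X) (z : Z) (a : Z.presheaf.stalk z) :
    Spec (Z.presheaf.stalk z) ⟶ 𝔸(Fin 1; X) :=
  AffineSpace.homOfVector (Z.fromSpecStalk z ≫ ι) (fun _ ↦ (Scheme.ΓSpecIso _).inv a)

/-- The value of `Tᵢ` if `T₁` has the value `a`. -/
def coordValue {R : Type*} [CommRing R] (a : R) (i : Fin 2) : R := ![1 - a, a] i

theorem map_coordValue {R R' : Type*} [CommRing R] [CommRing R'] (φ : R →+* R') (a : R)
    (i : Fin 2) : φ (coordValue a i) = coordValue (φ a) i := by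
  fin_cases i <;> simp [coordValue]

theorem simplexCoord_one (X : Scheme.{0}) (i : Fin 2) :
    simplexCoord X 1 i = coordValue (AffineSpace.coord X 0) i := by
  fin_cases i
  · simp [simplexCoord, coordValue]
  · rfl

theorem stalkHom_over (ι : Z ⟶ X) (z : Z) (a : Z.presheaf.stalk z) :
    stalkHom ι z a ≫ 𝔸(Fin 1; X) ↘ X = Z.fromSpecStalk z ≫ ι :=
  AffineSpace.homOfVector_over _ _

theorem stalkClosedPointTo_stalkHom (ι : Z ⟶ X) (z : Z) (a : Z.presheaf.stalk z) (i : Fin 2) :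
    Scheme.stalkClosedPointTo (stalkHom ι z a) ((𝔸(Fin 1; X)).presheaf.germ ⊤ _ trivial
      (simplexCoord X 1 i)) = coordValue a i := by
  rw [Scheme.stalkClosedPointTo_germ_top, simplexCoord_one]
  have h1 := map_coordValue ((Scheme.ΓSpecIso (Z.presheaf.stalk z)).hom.hom.comp
    (stalkHom ι z a).appTop.hom) (AffineSpace.coord X 0) i
  refine h1.trans ?_
  congr 1
  change (Scheme.ΓSpecIso _).hom ((stalkHom ι z a).appTop (AffineSpace.coord X 0)) = a
  rw [stalkHom, AffineSpace.homOfVector_appTop_coord]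
  simp

theorem SpecMap_stalkHom (ι : Z ⟶ X) {z z' : Z} (h : z' ⤳ z) (a : Z.presheaf.stalk z) :
    Spec.map (Z.presheaf.stalkSpecializes h) ≫ stalkHom ι z a =
      stalkHom ι z' (Z.presheaf.stalkSpecializes h a) := by
  rw [stalkHom, AffineSpace.comp_homOfVector, stalkHom]
  congr 1
  · simp
  · funext i
    simp only [Function.comp]
    rw [← CommRingCat.comp_apply, ← Scheme.ΓSpecIso_inv_naturality, CommRingCat.comp_apply]

/-- `coordValue 0 i` plays two roles: it is Tᵢ at T₁ = 0, and also the constant value of T₁ on the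
face Tᵢ = 0, namely 1 for i = 0 and 0 for i = 1. -/
theorem face_appTop_coord (X : Scheme.{0}) (i : Fin 2) (j : Fin 1) :
    (face X 0 i).appTop (AffineSpace.coord X j) = coordValue 0 i := by
  rw [face, faceMap, AffineSpace.homOfVector_appTop_coord]
  have : ∀ k, simplexCoord X 0 k = 1 := by
    intro k
    fin_cases k
    simp [simplexCoord]
  simp only [this]
  fin_cases i <;> fin_cases j <;> simp [coordValue, Finset.filter_singleton, Fin.ext_iff]

theorem coordValue_eq_zero {R : Type*} [CommRing R] {a : R} {i : Fin 2} (h : coordValue a i = 0) :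
    a = coordValue 0 i := by
  fin_cases i
  · simpa [coordValue] using (sub_eq_zero.1 h).symm
  · simpa [coordValue] using h

theorem coordValue_coordValue_zero {R : Type*} [CommRing R] (i : Fin 2) :
    coordValue (coordValue (0 : R) i) i = 0 := by
  fin_cases i <;> simp [coordValue]

/-- When Tᵢ is not a unit it vanishes in the residue field at z, so the restriction to the residue
field factors through the face. The point y is then determined by its image in X, since X × Δ⁰ is X.
-/
theorem stalkHom_closedPoint (ι : Z ⟶ X) (z : Z) (a : Z.presheaf.stalk z) {i : Fin 2}
    {y : 𝔸(Fin 0; X)} (hy : (𝔸(Fin 0; X) ↘ X) y = ι z) (ha : ¬ IsUnit (coordValue a i)) :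
    stalkHom ι z a (IsLocalRing.closedPoint _) = face X 0 i y := by
  let κ : CommRingCat.{0} := .of (IsLocalRing.ResidueField (Z.presheaf.stalk z))
  let π : Z.presheaf.stalk z ⟶ κ := CommRingCat.ofHom (IsLocalRing.residue (Z.presheaf.stalk z))
  let pt : Spec κ := IsLocalRing.closedPoint (IsLocalRing.ResidueField (Z.presheaf.stalk z))
  let y' : Spec κ ⟶ 𝔸(Fin 0; X) :=
    AffineSpace.homOfVector (Spec.map π ≫ Z.fromSpecStalk z ≫ ι) Fin.elim0
  have hpt : Spec.map π pt = IsLocalRing.closedPoint (Z.presheaf.stalk z) :=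
    IsLocalRing.comap_closedPoint (IsLocalRing.residue (Z.presheaf.stalk z))
  have hy' : y' pt = y := by
    apply (𝔸(Fin 0; X) ↘ X).isOpenEmbedding.injective
    have h1 : (𝔸(Fin 0; X) ↘ X) (y' pt) = ι (Z.fromSpecStalk z (Spec.map π pt)) := by
      rw [← Scheme.Hom.comp_apply, AffineSpace.homOfVector_over]; rfl
    rw [h1, hpt, hy, Scheme.fromSpecStalk_closedPoint]
  have hcomp : Spec.map π ≫ stalkHom ι z a = y' ≫ face X 0 i := by
    apply AffineSpace.hom_ext
    · rw [Category.assoc, stalkHom_over, Category.assoc, face, faceMap,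
        AffineSpace.homOfVector_over, AffineSpace.homOfVector_over]
    · intro j
      rw [Scheme.Hom.comp_appTop, Scheme.Hom.comp_appTop]
      change (Spec.map π).appTop ((stalkHom ι z a).appTop _) = y'.appTop ((face X 0 i).appTop _)
      rw [face_appTop_coord, stalkHom, AffineSpace.homOfVector_appTop_coord]
      have h1 : (Spec.map π).appTop ((Scheme.ΓSpecIso _).inv a) = (Scheme.ΓSpecIso κ).inv (π a) :=
        (ConcreteCategory.congr_hom (Scheme.ΓSpecIso_inv_naturality π) a).symm
      have h2 : π a = coordValue 0 i := by
        apply coordValue_eq_zero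
        rw [← map_coordValue π.hom a i]
        exact (IsLocalRing.residue_eq_zero_iff _).2 ha
      have h3 := map_coordValue (Scheme.ΓSpecIso κ).inv.hom 0 i
      have h4 := map_coordValue y'.appTop.hom 0 i
      rw [map_zero] at h3 h4
      rw [h1, h2]
      exact h3.trans h4.symm
  rw [← hpt, ← Scheme.Hom.comp_apply, hcomp, Scheme.Hom.comp_apply, hy']

theorem specializes_closedPoint_of_map {Y : Scheme.{0}} {R R' : CommRingCat.{0}}
    [IsLocalRing R] [IsLocalRing R'] (φ : R ⟶ R') (G : Spec R ⟶ Y) (g : Spec R' ⟶ Y)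
    (hg : Spec.map φ ≫ G = g) :
    g (IsLocalRing.closedPoint R') ⤳ G (IsLocalRing.closedPoint R) := by
  rw [← hg]
  change G (Spec.map φ _) ⤳ _
  exact (IsLocalRing.specializes_closedPoint _).map G.continuous

variable [IsIntegral Z]

/-- The local ring 𝒪_{Z,z} embeds in the function field, so a germ on X × Δ¹ vanishes at the generic
point of the graph exactly when it pulls back to 0 in 𝒪_{Z,z}. -/
theorem primeAt_stalkHom (ι : Z ⟶ X) (z : Z) (a : Z.presheaf.stalk z)
    (h : stalkHom ι (genericPoint Z) (algebraMap _ Z.functionField a)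
      (IsLocalRing.closedPoint Z.functionField) ⤳
        stalkHom ι z a (IsLocalRing.closedPoint (Z.presheaf.stalk z))) :
    primeAt h = RingHom.ker (Scheme.stalkClosedPointTo (stalkHom ι z a)).hom := by
  have key := Scheme.stalkSpecializes_stalkClosedPointTo
    (Z.presheaf.stalkSpecializes (genericPoint_specializes z)) (stalkHom ι z a) _
    (SpecMap_stalkHom ι (genericPoint_specializes z) a) h
  ext b
  have hb := ConcreteCategory.congr_hom key b
  have hb' : Scheme.stalkClosedPointTo (stalkHom ι (genericPoint Z)
      (algebraMap _ Z.functionField a)) ((𝔸(Fin 1; X)).presheaf.stalkSpecializes h b) =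
      algebraMap _ Z.functionField (Scheme.stalkClosedPointTo (stalkHom ι z a) b) := hb
  rw [primeAt, RingHom.mem_ker, RingHom.mem_ker]
  change (𝔸(Fin 1; X)).residue _ ((𝔸(Fin 1; X)).presheaf.stalkSpecializes h b) = 0 ↔
    Scheme.stalkClosedPointTo (stalkHom ι z a) b = 0
  rw [← (IsFractionRing.injective (Z.presheaf.stalk z) Z.functionField).eq_iff, map_zero, ← hb']
  have hloc : IsLocalHom (Scheme.stalkClosedPointTo (stalkHom ι (genericPoint Z)
      (algebraMap _ Z.functionField a))).hom := inferInstance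
  set c := (𝔸(Fin 1; X)).presheaf.stalkSpecializes h b
  refine (IsLocalRing.residue_eq_zero_iff c).trans ?_
  rw [IsLocalRing.mem_maximalIdeal, mem_nonunits_iff]
  constructor
  · intro hc
    by_contra hne
    exact hc (hloc.map_nonunit c (isUnit_iff_ne_zero.2 hne))
  · intro hc hu
    have := hu.map (Scheme.stalkClosedPointTo (stalkHom ι (genericPoint Z)
      (algebraMap _ Z.functionField a))).hom
    have h0 : IsUnit (0 : Z.functionField) := by rwa [← hc]
    exact not_isUnit_zero h0

/-- The local ring of the graph is 𝒪_{Z,z}: the kernel is `primeAt`, and the pullback to 𝒪_{Z,z} is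
surjective because already its restriction to functions coming from X is, ι being a closed
immersion. -/
theorem intersectionMult_stalkHom (ι : Z ⟶ X) [IsClosedImmersion ι] (z : Z)
    (a : Z.presheaf.stalk z) (i : Fin 2) :
    intersectionMult (stalkHom ι (genericPoint Z) (algebraMap _ Z.functionField a)
      (IsLocalRing.closedPoint Z.functionField)) (simplexCoord X 1 i)
        (stalkHom ι z a (IsLocalRing.closedPoint (Z.presheaf.stalk z))) =
      (Ring.ord (Z.presheaf.stalk z) (coordValue a i)).toNat := by
  have h := specializes_closedPoint_of_map _ _ _
    (SpecMap_stalkHom ι (genericPoint_specializes z) a)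
  have hs := Scheme.stalkClosedPointTo_fromSpecStalk_comp_surjective ι z _ (stalkHom_over ι z a).symm.symm
  rw [Scheme.stalkClosedPointTo_comp] at hs
  have hs' : Function.Surjective (Scheme.stalkClosedPointTo (stalkHom ι z a)).hom :=
    Function.Surjective.of_comp hs
  refine (dif_pos h).trans ?_
  let e := (Ideal.quotEquivOfEq (primeAt_stalkHom ι z a h)).trans
    (RingHom.quotientKerEquivOfSurjective hs')
  rw [← Ring.ord_ringEquiv e]
  congr 3
  exact stalkClosedPointTo_stalkHom ι z a i

/-- An inverse of Tᵢ on the graph that is regular at z forces Tᵢ to be a unit at any point over z in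
the closure of the graph, whereas Tᵢ is 0 on the face. This covers the points where T₁ itself is not
regular. -/
theorem not_specializes_face (ι : Z ⟶ X) [IsClosedImmersion ι] {z : Z} (τ : Z.functionField)
    {i : Fin 2} {y : 𝔸(Fin 0; X)} (hy : (𝔸(Fin 0; X) ↘ X) y = ι z) (a : Z.presheaf.stalk z)
    (ha : coordValue τ i * algebraMap _ Z.functionField a = 1) :
    ¬ stalkHom ι (genericPoint Z) τ (IsLocalRing.closedPoint Z.functionField) ⤳ face X 0 i y := by
  intro h
  set g := stalkHom ι (genericPoint Z) τ
  set p := face X 0 i y with hp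
  obtain ⟨b, hb⟩ := ι.stalkMap_surjective z a
  obtain ⟨U, hU, s, rfl⟩ := X.presheaf.exists_germ_eq b
  have hpU : (𝔸(Fin 1; X) ↘ X) p ∈ U := by
    have : face X 0 i ≫ (𝔸(Fin 1; X) ↘ X) = 𝔸(Fin 0; X) ↘ X := AffineSpace.homOfVector_over _ _
    rwa [hp, ← Scheme.Hom.comp_apply, this, hy]
  let ψ : (𝔸(Fin 1; X)).presheaf.stalk p →+* Z.functionField :=
    ((𝔸(Fin 1; X)).presheaf.stalkSpecializes h ≫ Scheme.stalkClosedPointTo g).hom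
  let b' := (𝔸(Fin 1; X)).presheaf.germ ((𝔸(Fin 1; X) ↘ X) ⁻¹ᵁ U) p hpU
    ((𝔸(Fin 1; X) ↘ X).app U s)
  let σ := (𝔸(Fin 1; X)).presheaf.germ ⊤ p trivial (simplexCoord X 1 i)
  have hσ : ψ σ = coordValue τ i := by
    rw [← stalkClosedPointTo_stalkHom ι (genericPoint Z) τ i]
    change Scheme.stalkClosedPointTo g ((𝔸(Fin 1; X)).presheaf.stalkSpecializes h _) = _
    congr 1
    exact TopCat.Presheaf.germ_stalkSpecializes_apply _ _ _ _
  have hb' : ψ b' = algebraMap _ Z.functionField a := by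
    have hηU : ι (genericPoint Z) ∈ U :=
      ((genericPoint_specializes z).map ι.continuous).mem_open U.2 hU
    have h1 := Scheme.stalkClosedPointTo_fromSpecStalk_comp_germ ι (genericPoint Z) _
      (stalkHom_over ι (genericPoint Z) τ) U hηU
      (by
        change (𝔸(Fin 1; X) ↘ X) (g _) ∈ U
        exact (h.map (𝔸(Fin 1; X) ↘ X).continuous).mem_open U.2 hpU) s
    rw [Scheme.stalkClosedPointTo_comp] at h1
    rw [← hb]
    change Scheme.stalkClosedPointTo g ((𝔸(Fin 1; X)).presheaf.stalkSpecializes h b') =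
      Z.presheaf.stalkSpecializes (genericPoint_specializes z) (ι.stalkMap z _)
    rw [Scheme.Hom.germ_stalkMap_apply]
    refine Eq.trans ?_ (h1.trans (TopCat.Presheaf.germ_stalkSpecializes_apply _ _ _ _).symm)
    change _ = Scheme.stalkClosedPointTo g ((𝔸(Fin 1; X) ↘ X).stalkMap _ _)
    congr 1
    exact (TopCat.Presheaf.germ_stalkSpecializes_apply _ _ _ _).trans
      ((𝔸(Fin 1; X) ↘ X).germ_stalkMap_apply U _ _ _).symm
  -- `b'` lifts the inverse of Tᵢ, so σb' - 1 dies in a field and cannot be a unit. In a local ring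
  -- σb' is then a unit.
  have hunit : IsUnit σ := by
    have h1 : ψ (σ * b' - 1) = 0 := by rw [map_sub, map_mul, hσ, hb', ha, map_one, sub_self]
    have h2 : σ * b' - 1 ∈ nonunits _ := by
      intro hu
      have := hu.map ψ
      rw [h1] at this
      exact not_isUnit_zero this
    have h3 : IsUnit (σ * b') := by
      by_contra hn
      have := IsLocalRing.nonunits_add hn (mt (fun hu : IsUnit (-(σ * b' - 1)) ↦ by simpa using hu.neg) h2)
      simp at this
    exact isUnit_of_mul_isUnit_left h3
  have hz : (face X 0 i).stalkMap y σ = 0 := by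
    refine ((face X 0 i).germ_stalkMap_apply ⊤ y trivial _).trans ?_
    have : (face X 0 i).app ⊤ (simplexCoord X 1 i) = 0 := by
      rw [simplexCoord_one]
      have h1 := map_coordValue ((face X 0 i).app ⊤).hom (AffineSpace.coord X 0) i
      refine h1.trans ?_
      have h2 : ((face X 0 i).app ⊤).hom (AffineSpace.coord X 0) = _ := face_appTop_coord X i 0
      rw [h2]
      exact coordValue_coordValue_zero i
    rw [this, map_zero]
  have := hunit.map ((face X 0 i).stalkMap y).hom
  have h0 : IsUnit (0 : (𝔸(Fin 0; X)).presheaf.stalk y) := by rwa [← hz]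
  exact not_isUnit_zero h0

/-- The closure of the graph lies over the closed image of Z. -/
theorem exists_eq_of_specializes_face (ι : Z ⟶ X) [IsClosedImmersion ι] (τ : Z.functionField)
    {i : Fin 2} {y : 𝔸(Fin 0; X)}
    (h : stalkHom ι (genericPoint Z) τ (IsLocalRing.closedPoint Z.functionField) ⤳ face X 0 i y) :
    ∃ z, (𝔸(Fin 0; X) ↘ X) y = ι z := by
  have h1 := h.map (𝔸(Fin 1; X) ↘ X).continuous
  have h2 : (𝔸(Fin 1; X) ↘ X) (face X 0 i y) = (𝔸(Fin 0; X) ↘ X) y := by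
    rw [← Scheme.Hom.comp_apply, face, faceMap, AffineSpace.homOfVector_over]
  have h3 : (𝔸(Fin 1; X) ↘ X) (stalkHom ι (genericPoint Z) τ
      (IsLocalRing.closedPoint Z.functionField)) ∈ Set.range ι := by
    refine ⟨Z.fromSpecStalk (genericPoint Z) (IsLocalRing.closedPoint Z.functionField), ?_⟩
    change (Z.fromSpecStalk (genericPoint Z) ≫ ι) _ = (stalkHom ι (genericPoint Z) τ ≫ _) _
    rw [stalkHom_over]
  rw [h2] at h1
  obtain ⟨z, hz⟩ := h1.mem_closed ι.isClosedEmbedding.isClosed_range h3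
  exact ⟨z, hz.symm⟩

end BlochChow

/-! ### Boundary and admissibility of the graph -/

namespace BlochChow

variable {Z X : Scheme.{0}} [IsIntegral Z]

theorem stalkHom_genericPoint_over (ι : Z ⟶ X) (τ : Z.functionField) :
    (𝔸(Fin 1; X) ↘ X) (stalkHom ι (genericPoint Z) τ (IsLocalRing.closedPoint Z.functionField)) =
      ι (genericPoint Z) := by
  have h1 : (𝔸(Fin 1; X) ↘ X)
      (stalkHom ι (genericPoint Z) τ (IsLocalRing.closedPoint Z.functionField)) =
      (Z.fromSpecStalk (genericPoint Z) ≫ ι) (IsLocalRing.closedPoint Z.functionField) := by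
    rw [← stalkHom_over ι (genericPoint Z) τ]
    rfl
  rw [h1]
  exact congrArg ι Scheme.fromSpecStalk_closedPoint

theorem face_over (X : Scheme.{0}) (i : Fin 2) (y : 𝔸(Fin 0; X)) :
    (𝔸(Fin 1; X) ↘ X) (face X 0 i y) = (𝔸(Fin 0; X) ↘ X) y := by
  rw [← Scheme.Hom.comp_apply, face, faceMap, AffineSpace.homOfVector_over]

theorem graphPoint_eq (ι : Z ⟶ X) (f : Z.functionField) :
    graphPoint ι f = stalkHom ι (genericPoint Z) (1 / (1 - f))
      (IsLocalRing.closedPoint Z.functionField) := rfl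

theorem intersectionMult_of_not_specializes {Y : Scheme.{0}} {w p : Y} (s : Γ(Y, ⊤))
    (h : ¬ w ⤳ p) : intersectionMult w s p = 0 := dif_neg h

theorem graphPoint_face_of_coordValue (ι : Z ⟶ X) [IsClosedImmersion ι] {z : Z} {f : Z.functionField}
    {y : 𝔸(Fin 0; X)} (hy : (𝔸(Fin 0; X) ↘ X) y = ι z) (i : Fin 2) (b : Z.presheaf.stalk z)
    (hb : algebraMap _ Z.functionField b = 1 / (1 - f)) (hi : ¬ IsUnit (coordValue b i)) :
    graphPoint ι f ⤳ face X 0 i y ∧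
      intersectionMult (graphPoint ι f) (simplexCoord X 1 i) (face X 0 i y) =
        (Ring.ord (Z.presheaf.stalk z) (coordValue b i)).toNat := by
  rw [graphPoint_eq, ← hb, ← stalkHom_closedPoint ι z b hy hi]
  exact ⟨specializes_closedPoint_of_map _ _ _
    (SpecMap_stalkHom ι (genericPoint_specializes z) b), intersectionMult_stalkHom ι z b i⟩

theorem graphPoint_face_of_zero (ι : Z ⟶ X) [IsClosedImmersion ι] {z : Z} {f : Z.functionField}
    {y : 𝔸(Fin 0; X)} (hy : (𝔸(Fin 0; X) ↘ X) y = ι z)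
    (a : Z.presheaf.stalk z) (hf : algebraMap _ Z.functionField a = f) (ha : ¬ IsUnit a) :
    (graphPoint ι f ⤳ face X 0 0 y ∧
      intersectionMult (graphPoint ι f) (simplexCoord X 1 0) (face X 0 0 y) =
        (Ring.ord (Z.presheaf.stalk z) a).toNat) ∧ ¬ graphPoint ι f ⤳ face X 0 1 y := by
  obtain ⟨u, hu⟩ := IsLocalRing.isUnit_one_sub_self_of_mem_nonunits a ha
  have hinv : (1 - a) * (↑u⁻¹ : Z.presheaf.stalk z) = 1 := by rw [← hu]; simp
  have hinv' := congrArg (algebraMap _ Z.functionField) hinv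
  rw [map_mul, map_sub, map_one, hf] at hinv'
  have hne : (1 - f) ≠ 0 := left_ne_zero_of_mul_eq_one hinv'
  have hval : coordValue (↑u⁻¹ : Z.presheaf.stalk z) 0 = -(a * ↑u⁻¹) := by
    simp only [coordValue, Matrix.cons_val_zero]
    linear_combination -hinv
  constructor
  · have h := graphPoint_face_of_coordValue ι hy (f := f) 0 ↑u⁻¹
      (by rw [eq_div_iff hne, mul_comm, hinv']) (by
        rw [hval, IsUnit.neg_iff]
        exact fun h ↦ ha (isUnit_of_mul_isUnit_left h))
    rwa [hval, Ring.ord_neg, Ring.ord_mul_of_isUnit_right (Units.isUnit _)] at h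
  -- The inverse of T₁ = 1/(1 - f) is 1 - f, here equal to 1 - a.
  · refine not_specializes_face ι _ hy (1 - a) ?_
    simp only [coordValue, Matrix.cons_val_one, Matrix.cons_val_zero, map_sub, map_one, hf]
    field_simp

theorem graphPoint_face_of_pole (ι : Z ⟶ X) [IsClosedImmersion ι] {z : Z} {f : Z.functionField}
    {y : 𝔸(Fin 0; X)} (hy : (𝔸(Fin 0; X) ↘ X) y = ι z)
    (a : Z.presheaf.stalk z) (hf : algebraMap _ Z.functionField a = f⁻¹) (hf0 : f ≠ 0)
    (ha : ¬ IsUnit a) :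
    (graphPoint ι f ⤳ face X 0 1 y ∧
      intersectionMult (graphPoint ι f) (simplexCoord X 1 1) (face X 0 1 y) =
        (Ring.ord (Z.presheaf.stalk z) a).toNat) ∧ ¬ graphPoint ι f ⤳ face X 0 0 y := by
  obtain ⟨u, hu⟩ := IsLocalRing.isUnit_one_sub_self_of_mem_nonunits a ha
  have hinv : (1 - a) * (↑u⁻¹ : Z.presheaf.stalk z) = 1 := by rw [← hu]; simp
  have hinv' := congrArg (algebraMap _ Z.functionField) hinv
  rw [map_mul, map_sub, map_one, hf] at hinv'
  have hne : (1 - f⁻¹) ≠ 0 := left_ne_zero_of_mul_eq_one hinv'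
  have hne' : (1 - f) ≠ 0 := by
    intro h
    rw [sub_eq_zero] at h
    rw [← h] at hne
    simp at hne
  have hval : coordValue (-(a * ↑u⁻¹) : Z.presheaf.stalk z) 1 = -(a * ↑u⁻¹) := rfl
  constructor
  -- With a = 1/f one has T₁ = 1/(1 - f) = -a/(1 - a).
  · have h := graphPoint_face_of_coordValue ι hy (f := f) 1 (-(a * ↑u⁻¹))
      (by
        rw [map_neg, map_mul, hf, eq_div_iff hne']
        field_simp at hinv' ⊢
        linear_combination hinv') (by
        rw [hval, IsUnit.neg_iff]
        exact fun h ↦ ha (isUnit_of_mul_isUnit_left h))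
    rwa [hval, Ring.ord_neg, Ring.ord_mul_of_isUnit_right (Units.isUnit _)] at h
  -- The inverse of T₀ = -f/(1 - f) is 1 - 1/f = 1 - a.
  · refine not_specializes_face ι _ hy (1 - a) ?_
    simp only [coordValue, Matrix.cons_val_zero, map_sub, map_one, hf]
    field_simp
    ring

/-- The inverses 1 - 1/f of T₀ and 1 - f of T₁ are both regular at z. Where f takes the value 1 the
graph runs off to infinity in Δ¹. -/
theorem graphPoint_face_of_isUnit (ι : Z ⟶ X) [IsClosedImmersion ι] {z : Z} {f : Z.functionField}
    {y : 𝔸(Fin 0; X)} (hy : (𝔸(Fin 0; X) ↘ X) y = ι z)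
    (a : Z.presheaf.stalk z) (hf : algebraMap _ Z.functionField a = f) (hf1 : f ≠ 1)
    (ha : IsUnit a) (i : Fin 2) : ¬ graphPoint ι f ⤳ face X 0 i y := by
  obtain ⟨u, rfl⟩ := ha
  have hne : (1 - f) ≠ 0 := sub_ne_zero.2 hf1.symm
  have hf0 : f ≠ 0 := by
    rw [← hf]
    exact ((u.isUnit).map (algebraMap _ Z.functionField)).ne_zero
  have hinv : algebraMap _ Z.functionField (↑u⁻¹ : Z.presheaf.stalk z) = f⁻¹ := by
    exact eq_inv_of_mul_eq_one_left (by rw [← hf, ← map_mul]; simp)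
  fin_cases i
  · refine not_specializes_face ι _ hy (1 - ↑u⁻¹) ?_
    simp only [coordValue, Fin.zero_eta, Matrix.cons_val_zero, map_sub, map_one, hinv]
    field_simp
    ring
  · refine not_specializes_face ι _ hy (1 - ↑u) ?_
    simp only [coordValue, Fin.mk_one, Matrix.cons_val_one, Matrix.cons_val_zero, map_sub, map_one, hf]
    field_simp

/-- The rational function `f` has a zero of order `n` at `P`, a pole of order `n` at `Q`, and is
invertible at all other points. -/
structure HasZeroPole (f : Z.functionField) (P Q : Z) (n : ℕ) : Prop where
  zero : ∃ a : Z.presheaf.stalk P, algebraMap _ Z.functionField a = f ∧ Ring.ord _ a = n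
  pole : ∃ a : Z.presheaf.stalk Q, algebraMap _ Z.functionField a = f⁻¹ ∧ Ring.ord _ a = n
  unit : ∀ z, z ≠ P → z ≠ Q → ∃ a : Z.presheaf.stalk z, algebraMap _ Z.functionField a = f ∧ IsUnit a

namespace HasZeroPole

variable {f : Z.functionField} {P Q : Z} {n : ℕ}

theorem inv (h : HasZeroPole f P Q n) : HasZeroPole f⁻¹ Q P n := by
  refine ⟨h.pole, by simpa using h.zero, fun z hQ hP ↦ ?_⟩
  obtain ⟨a, ha, hu⟩ := h.unit z hP hQ
  obtain ⟨u, rfl⟩ := hu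
  refine ⟨↑u⁻¹, ?_, Units.isUnit _⟩
  rw [← ha]
  exact eq_inv_of_mul_eq_one_left (by rw [← map_mul]; simp)

theorem not_isUnit {R : Type*} [CommRing R] (hn : n ≠ 0) {a : R} (ha : Ring.ord R a = n) :
    ¬ IsUnit a := by
  intro hu
  rw [Ring.ord_of_isUnit hu] at ha
  exact hn (by exact_mod_cast ha.symm)

theorem ne_one (h : HasZeroPole f P Q n) (hn : n ≠ 0) : f ≠ 1 := by
  obtain ⟨a, ha, ho⟩ := h.zero
  intro h1
  rw [h1, ← map_one (algebraMap (Z.presheaf.stalk P) Z.functionField)] at ha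
  have := IsFractionRing.injective (Z.presheaf.stalk P) Z.functionField ha
  exact not_isUnit hn ho (this ▸ isUnit_one)

theorem ne (h : HasZeroPole f P Q n) (hn : n ≠ 0) (hf : f ≠ 0) : P ≠ Q := by
  rintro rfl
  obtain ⟨a, ha, ho⟩ := h.zero
  obtain ⟨b, hb, -⟩ := h.pole
  refine not_isUnit hn ho (IsUnit.of_mul_eq_one b ?_)
  apply IsFractionRing.injective (Z.presheaf.stalk P) Z.functionField
  rw [map_mul, ha, hb, map_one, mul_inv_cancel₀ hf]

theorem hasDivisor [IsLocallyNoetherian Z] {f : Z.functionFieldˣ}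
    (h : HasZeroPole (f : Z.functionField) P Q n) (hn : n ≠ 0)
    (hP : Order.coheight P = 1) (hQ : Order.coheight Q = 1) :
    HasDivisor f (Finsupp.single P (n : ℤ) - Finsupp.single Q (n : ℤ)) := by
  classical
  have hPQ : P ≠ Q := h.ne hn f.ne_zero
  have key {z : Z} (hz : Order.coheight z = 1) {g : Z.functionField} {a : Z.presheaf.stalk z}
      {k : ℕ} (hg : g ≠ 0) (ha : algebraMap _ Z.functionField a = g) (ho : Ring.ord _ a = k) :
      Scheme.ordHom z hz g = Multiplicative.ofAdd (k : ℤ) := by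
    have : Ring.KrullDimLE 1 (Z.presheaf.stalk z) := krullDimLE_of_coheight_le hz.le
    have ha0 : a ≠ 0 := by rintro rfl; exact hg (by rw [← ha, map_zero])
    rw [← ha]
    exact (Ring.ordFrac_eq_ord _ ha0).trans
      (Ring.ordMonoidWithZeroHom_eq_coe _ (mem_nonZeroDivisors_of_ne_zero ha0) ho)
  intro z
  by_cases hzP : z = P
  · subst hzP
    obtain ⟨a, ha, ho⟩ := h.zero
    rw [Finsupp.sub_apply, Finsupp.single_eq_same, Finsupp.single_eq_of_ne hPQ, sub_zero,
      Scheme.ord_eq_iff hP f.ne_zero]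
    exact key hP f.ne_zero ha ho
  by_cases hzQ : z = Q
  · subst hzQ
    obtain ⟨a, ha, ho⟩ := h.pole
    rw [Finsupp.sub_apply, Finsupp.single_eq_same, Finsupp.single_eq_of_ne hzP, zero_sub,
      Scheme.ord_eq_iff hQ f.ne_zero]
    have := key hQ (inv_ne_zero f.ne_zero) ha ho
    rw [map_inv₀, inv_eq_iff_eq_inv] at this
    rw [this]
    simp
  · rw [Finsupp.sub_apply, Finsupp.single_eq_of_ne hzP, Finsupp.single_eq_of_ne hzQ, sub_zero]
    by_cases hz : Order.coheight z = 1
    · obtain ⟨a, ha, hu⟩ := h.unit z hzP hzQ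
      rw [Scheme.ord_eq_iff hz f.ne_zero]
      exact_mod_cast key hz f.ne_zero ha (k := 0) (by rw [Ring.ord_of_isUnit hu]; rfl)
    -- Outside codimension one `Scheme.ord` is 0 by convention.
    · exact Scheme.ord_eq_zero_of_coheight_neq_one hz _

variable (ι : Z ⟶ X) [IsClosedImmersion ι]

theorem eq_of_specializes_face (h : HasZeroPole f P Q n) (hn : n ≠ 0) {i : Fin 2}
    {y : 𝔸(Fin 0; X)} (hs : graphPoint ι f ⤳ face X 0 i y) :
    (𝔸(Fin 0; X) ↘ X) y = ι P ∨ (𝔸(Fin 0; X) ↘ X) y = ι Q := by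
  obtain ⟨z, hz⟩ := exists_eq_of_specializes_face ι _ hs
  by_cases hP : z = P
  · exact .inl (hP ▸ hz)
  by_cases hQ : z = Q
  · exact .inr (hQ ▸ hz)
  obtain ⟨a, ha, hu⟩ := h.unit z hP hQ
  exact absurd hs (graphPoint_face_of_isUnit ι hz a ha (h.ne_one hn) hu i)

/-- Zeros are counted on the face T₀ = 0 with sign +1 and poles on T₁ = 0 with sign -1, which
together give the push-forward of div f to X. -/
theorem boundary_graph {f : Z.functionFieldˣ} (h : HasZeroPole (f : Z.functionField) P Q n)
    (hn : n ≠ 0) :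
    boundary X 2 0 (graph ι f) = fun y ↦ open Classical in
      if Order.coheight y = (2 : ℕ) then
        Finsupp.single (ι P) (n : ℤ) ((𝔸(Fin 0; X) ↘ X) y) -
          Finsupp.single (ι Q) (n : ℤ) ((𝔸(Fin 0; X) ↘ X) y)
      else 0 := by
  classical
  have hf1 : f ≠ 1 := fun h1 ↦ h.ne_one hn (by rw [h1]; rfl)
  have hPQ : ι P ≠ ι Q := fun e ↦ h.ne hn f.ne_zero (ι.isClosedEmbedding.injective e)
  funext y
  rw [graph, if_neg hf1, boundary, Finsupp.liftAddHom_apply_single]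
  simp only [zmultiplesHom_apply, one_smul]
  split_ifs with hy
  · let M : Fin 2 → ℤ := fun i ↦
      intersectionMult (graphPoint ι (f : Z.functionField)) (simplexCoord X 1 i) (face X 0 i y)
    have hM (i : Fin 2) (hi : ¬ graphPoint ι (f : Z.functionField) ⤳ face X 0 i y) : M i = 0 :=
      intersectionMult_of_not_specializes _ hi
    change ∑ i : Fin 2, (-1) ^ (i : ℕ) * M i = _
    rw [Fin.sum_univ_two]
    simp only [Fin.val_zero, pow_zero, one_mul, Fin.val_one, pow_one]
    by_cases hP : (𝔸(Fin 0; X) ↘ X) y = ι P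
    · obtain ⟨a, ha, ho⟩ := h.zero
      obtain ⟨⟨-, h1⟩, h2⟩ := graphPoint_face_of_zero ι hP a ha (not_isUnit hn ho)
      have h1' : M 0 = _ := h1
      rw [hP, Finsupp.single_eq_same, Finsupp.single_eq_of_ne hPQ, h1', hM 1 h2, ho]
      simp
    by_cases hQ : (𝔸(Fin 0; X) ↘ X) y = ι Q
    · obtain ⟨a, ha, ho⟩ := h.pole
      obtain ⟨⟨-, h1⟩, h2⟩ := graphPoint_face_of_pole ι hQ a ha f.ne_zero (not_isUnit hn ho)
      have h1' : M 1 = _ := h1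
      rw [hQ, Finsupp.single_eq_same, Finsupp.single_eq_of_ne hPQ.symm, h1', hM 0 h2, ho]
      simp
    · rw [Finsupp.single_eq_of_ne hP, Finsupp.single_eq_of_ne hQ]
      have h0 : ∀ i, ¬ graphPoint ι (f : Z.functionField) ⤳ face X 0 i y := fun i hs ↦
        (h.eq_of_specializes_face ι hn hs).elim hP hQ
      rw [hM 0 (h0 0), hM 1 (h0 1)]
      simp
  · rfl

/-- At most 2: the graph specializes strictly to a face point over P, whose codimension is at most
3. At least 2: the graph lies in Z × Δ¹, a proper closed subset of X × Δ¹, and is not dense in it.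
-/
theorem coheight_graphPoint (h : HasZeroPole f P Q n) (hn : n ≠ 0) (hf : f ≠ 0)
    (hP : P ≠ genericPoint Z) [IrreducibleSpace X] {x : X} (hx : x ∉ Set.range ι)
    (hX : ∀ y : 𝔸(Fin 1; X), Order.coheight y ≤ 3) : Order.coheight (graphPoint ι f) = 2 := by
  apply le_antisymm
  · obtain ⟨y, hy⟩ := (𝔸(Fin 0; X) ↘ X).surjective (ι P)
    obtain ⟨a, ha, ho⟩ := h.zero
    obtain ⟨⟨hs, -⟩, -⟩ := graphPoint_face_of_zero ι hy a ha (not_isUnit hn ho)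
    have hlt : face X 0 0 y < graphPoint ι f := by
      rw [lt_iff_le_not_ge]
      refine ⟨hs, fun hs' : face X 0 0 y ⤳ graphPoint ι f ↦ hP ?_⟩
      have he := (hs.antisymm hs').eq
      have := congrArg (𝔸(Fin 1; X) ↘ X) he
      rw [graphPoint_eq] at this
      have h3 := (stalkHom_genericPoint_over ι _).symm.trans (this.trans (face_over X 0 y))
      exact (ι.isClosedEmbedding.injective (h3.trans hy)).symm
    have h1 := (Order.coheight_add_one_le hlt).trans (hX _)
    have h2 : Order.coheight (graphPoint ι f) + 1 ≤ 2 + 1 := h1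
    exact (ENat.add_le_add_iff_right ENat.one_ne_top).1 h2
  · have hmap : stalkHom (𝟙 Z) (genericPoint Z) (1 / (1 - f)) ≫ AffineSpace.map (Fin 1) ι =
        stalkHom ι (genericPoint Z) (1 / (1 - f)) := by
      apply AffineSpace.hom_ext
      · rw [Category.assoc, AffineSpace.map_over, ← Category.assoc, stalkHom_over, stalkHom_over,
          Category.comp_id]
      · intro i
        rw [Scheme.Hom.comp_appTop]
        change (stalkHom (𝟙 Z) _ _).appTop ((AffineSpace.map (Fin 1) ι).appTop _) = _
        rw [AffineSpace.map_appTop_coord, stalkHom, AffineSpace.homOfVector_appTop_coord, stalkHom,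
          AffineSpace.homOfVector_appTop_coord]
    have hw : AffineSpace.map (Fin 1) ι (graphPoint (𝟙 Z) f) = graphPoint ι f := by
      rw [graphPoint_eq, graphPoint_eq, ← hmap]
      rfl
    obtain ⟨y, hy⟩ := exists_notMem_range_map ι (Fin 1) hx
    rw [← hw]
    have h1 := coheight_add_one_le_of_isClosedImmersion (AffineSpace.map (Fin 1) ι) hy
      (graphPoint (𝟙 Z) f)
    refine le_trans ?_ h1
    have : (2 : ℕ∞) = 1 + 1 := rfl
    rw [this]
    gcongr
    apply one_le_coheight
    -- A dense graph would meet the face over the generic point of Z, where f is a unit different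
    -- from 1.
    intro hgen
    obtain ⟨y, hy⟩ := (𝔸(Fin 0; Z) ↘ Z).surjective (genericPoint Z)
    have hs : graphPoint (𝟙 Z) f ⤳ face Z 0 0 y := hgen ▸ genericPoint_specializes _
    obtain ⟨a, ha⟩ : ∃ a, (stalkFunctionFieldAlgebra Z (genericPoint Z)).algebraMap a = f := by
      refine ⟨f, ?_⟩
      change Z.presheaf.stalkSpecializes (genericPoint_specializes (genericPoint Z)) f = f
      rw [TopCat.Presheaf.stalkSpecializes_refl]
      rfl
    refine graphPoint_face_of_isUnit (𝟙 Z) (z := genericPoint Z) hy a ha (h.ne_one hn) ?_ 0 hs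
    have ha0 : a ≠ 0 := by rintro rfl; exact hf (by rw [← ha, map_zero])
    exact isUnit_iff_ne_zero (G₀ := Z.functionField).2 ha0

/-- The only proper faces of Δ¹ are its two vertices, and the closure of the graph meets them only
over P and Q, which have codimension at least 2 in X. -/
theorem isAdmissible_graphPoint (h : HasZeroPole f P Q n) (hn : n ≠ 0)
    (hw : Order.coheight (graphPoint ι f) = 2) (hP : 2 ≤ Order.coheight (ι P))
    (hQ : 2 ≤ Order.coheight (ι Q)) : IsAdmissible X 2 1 (graphPoint ι f) := by
  refine ⟨by exact_mod_cast hw, fun m hm ρ y hs ↦ ?_⟩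
  obtain rfl : m = 0 := by omega
  have hρ : ∃ i : Fin 2, ρ = Fin.succAboveOrderEmb i := by
    have h0 : ρ 0 = 0 ∨ ρ 0 = 1 := by
      generalize ρ 0 = k
      fin_cases k <;> simp
    rcases h0 with h0 | h0
    · refine ⟨1, ?_⟩
      ext j
      fin_cases j
      simp [h0]
    · refine ⟨0, ?_⟩
      ext j
      fin_cases j
      simp [h0]
  obtain ⟨i, rfl⟩ := hρ
  have hc : Order.coheight y = Order.coheight ((𝔸(Fin 0; X) ↘ X) y) :=
    (coheight_eq_of_isOpenImmersion (𝔸(Fin 0; X) ↘ X)).symm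
  rw [hc]
  rcases h.eq_of_specializes_face ι hn hs with e | e <;> rw [e] <;> assumption

end HasZeroPole

end BlochChow

/-! ### Local rings of ℙ³ in homogeneous coordinates -/

namespace ShiodaQuintic

attribute [local instance] MvPolynomial.gradedAlgebra

open MvPolynomial

/-- The homogeneous prime ideal of a point of `ℙ³`. -/
def pointPrime (x : P3) : Ideal S :=
  (ProjectiveSpectrum.asHomogeneousIdeal (𝒜 := homogeneousSubmodule (Fin 4) ℂ) x).toIdeal

instance (x : P3) : (pointPrime x).IsPrime :=
  ProjectiveSpectrum.isPrime (𝒜 := homogeneousSubmodule (Fin 4) ℂ) x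

/-- The germ of the fraction `G / H` of two forms of the same degree. -/
def fracGerm (x : P3) {n : ℕ} (G H : S) (hG : G.IsHomogeneous n) (hH : H.IsHomogeneous n)
    (hx : H ∉ pointPrime x) : P3.presheaf.stalk x :=
  (Proj.stalkIso (homogeneousSubmodule (Fin 4) ℂ) x).inv
    (HomogeneousLocalization.mk ⟨n, ⟨G, hG⟩, ⟨H, hH⟩, hx⟩)

/-- The embedding of the local ring of `ℙ³` into the localization of the coordinate ring. -/
def stalkToLocalization (x : P3) : P3.presheaf.stalk x →+* Localization.AtPrime (pointPrime x) :=
  (algebraMap (HomogeneousLocalization.AtPrime (homogeneousSubmodule (Fin 4) ℂ) (pointPrime x))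
    (Localization.AtPrime (pointPrime x))).comp
      (Proj.stalkIso (homogeneousSubmodule (Fin 4) ℂ) x).hom.hom

theorem stalkToLocalization_injective (x : P3) : Function.Injective (stalkToLocalization x) := by
  have h1 : Function.Injective (Proj.stalkIso (homogeneousSubmodule (Fin 4) ℂ) x).hom :=
    (ConcreteCategory.bijective_of_isIso _).1
  exact (HomogeneousLocalization.val_injective _).comp h1

theorem stalkToLocalization_fracGerm (x : P3) {n : ℕ} (G H : S) (hG : G.IsHomogeneous n)
    (hH : H.IsHomogeneous n) (hx : H ∉ pointPrime x) :
    stalkToLocalization x (fracGerm x G H hG hH hx) = Localization.mk G ⟨H, hx⟩ := by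
  have h1 : (Proj.stalkIso (homogeneousSubmodule (Fin 4) ℂ) x).hom (fracGerm x G H hG hH hx) =
    HomogeneousLocalization.mk ⟨n, ⟨G, hG⟩, ⟨H, hH⟩, hx⟩ :=
      Iso.inv_hom_id_apply _ _
  change HomogeneousLocalization.val ((Proj.stalkIso _ x).hom _) = _
  rw [h1]
  rfl

theorem exists_eq_fracGerm (x : P3) (s : P3.presheaf.stalk x) :
    ∃ (n : ℕ) (G H : S) (hG : G.IsHomogeneous n) (hH : H.IsHomogeneous n)
      (hx : H ∉ pointPrime x), s = fracGerm x G H hG hH hx := by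
  obtain ⟨⟨n, ⟨G, hG⟩, ⟨H, hH⟩, hx⟩, h⟩ := HomogeneousLocalization.mk_surjective
    ((Proj.stalkIso (homogeneousSubmodule (Fin 4) ℂ) x).hom s)
  refine ⟨n, G, H, hG, hH, hx, ?_⟩
  refine Eq.trans ?_ (congrArg (Proj.stalkIso (homogeneousSubmodule (Fin 4) ℂ) x).inv h).symm
  exact (Iso.hom_inv_id_apply _ _).symm

theorem isUnit_fracGerm_iff (x : P3) {n : ℕ} (G H : S) (hG : G.IsHomogeneous n)
    (hH : H.IsHomogeneous n) (hx : H ∉ pointPrime x) :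
    IsUnit (fracGerm x G H hG hH hx) ↔ G ∉ pointPrime x := by
  have h1 := MulEquiv.isUnit_map
    (Proj.stalkIso (homogeneousSubmodule (Fin 4) ℂ) x).symm.commRingCatIsoToRingEquiv
    (x := HomogeneousLocalization.mk (x := (pointPrime x).primeCompl) ⟨n, ⟨G, hG⟩, ⟨H, hH⟩, hx⟩)
  refine h1.trans ?_
  refine (HomogeneousLocalization.isUnit_iff_isUnit_val _ (pointPrime x) _).symm.trans ?_
  rw [HomogeneousLocalization.val_mk, Localization.mk_eq_mk']
  exact IsLocalization.AtPrime.isUnit_mk'_iff _ (pointPrime x) G ⟨H, hx⟩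

theorem stalkSpecializes_fracGerm {x x' : P3} (h : x' ⤳ x) {n : ℕ} (G H : S)
    (hG : G.IsHomogeneous n) (hH : H.IsHomogeneous n) (hx : H ∉ pointPrime x)
    (hx' : H ∉ pointPrime x') :
    P3.presheaf.stalkSpecializes h (fracGerm x G H hG hH hx) = fracGerm x' G H hG hH hx' := by
  exact TopCat.Presheaf.germ_stalkSpecializes_apply P3.presheaf _ _ _

theorem X_pow_notMem {x : P3} {j : Fin 4} (hj : (X j : S) ∉ pointPrime x) (n : ℕ) :
    (X j ^ n : S) ∉ pointPrime x := fun h ↦ hj (Ideal.IsPrime.mem_of_pow_mem inferInstance n h)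

theorem isHomogeneous_X_pow (j : Fin 4) (n : ℕ) : (X j ^ n : S).IsHomogeneous n := by
  simpa using (isHomogeneous_X ℂ j).pow n

/-- This is G(x/xⱼ)·xⱼⁿ = G(x), checked on monomials. It shows that substituting the ratios Xᵢ/Xⱼ in
a form agrees with dividing the form by Xⱼⁿ. -/
theorem map_mul_pow_of_isHomogeneous {L : Type*} [CommRing L] (φ g : S →+* L) {j : Fin 4}
    (hC : ∀ c, φ (C c) = g (C c)) (hX : ∀ i, φ (X i) * g (X j) = g (X i)) {n : ℕ} {G : S}
    (hG : G.IsHomogeneous n) : φ G * g (X j) ^ n = g G := by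
  have hsum := congrArg φ G.support_sum_monomial_coeff
  conv_rhs => rw [← G.support_sum_monomial_coeff]
  rw [map_sum] at hsum
  rw [map_sum, ← hsum, Finset.sum_mul]
  refine Finset.sum_congr rfl fun d hd ↦ ?_
  have hdeg : ∑ i ∈ d.support, d i = n := by
    rw [← hG (mem_support_iff.1 hd), Finsupp.weight_apply]
    simp [Finsupp.sum]
  rw [monomial_eq, Finsupp.prod, map_mul, map_prod, map_mul, map_prod, mul_assoc, ← hdeg,
    ← Finset.prod_pow_eq_pow_sum, ← Finset.prod_mul_distrib, hC]
  congr 1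
  refine Finset.prod_congr rfl fun i _ ↦ ?_
  rw [map_pow, map_pow, ← mul_pow, hX]

/-- Dehomogenization with respect to a coordinate that does not vanish at `x`, with values in the
local ring at `x`. -/
def dehom (x : P3) (j : Fin 4) (hj : (X j : S) ∉ pointPrime x) : S →+* P3.presheaf.stalk x :=
  eval₂Hom ((Proj.stalkIso (homogeneousSubmodule (Fin 4) ℂ) x).inv.hom.comp
    ((HomogeneousLocalization.fromZeroRingHom _ _).comp
      (algebraMap ℂ (homogeneousSubmodule (Fin 4) ℂ 0))))
    fun i ↦ fracGerm x (X i) (X j) (isHomogeneous_X ℂ i) (isHomogeneous_X ℂ j) hj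

theorem dehom_X (x : P3) (j : Fin 4) (hj : (X j : S) ∉ pointPrime x) (i : Fin 4) :
    dehom x j hj (X i) =
      fracGerm x (X i) (X j) (isHomogeneous_X ℂ i) (isHomogeneous_X ℂ j) hj := by
  simp [dehom]

theorem one_notMem_pointPrime (x : P3) : (1 : S) ∉ pointPrime x :=
  (Ideal.ne_top_iff_one _).1 Ideal.IsPrime.ne_top'

theorem dehom_C (x : P3) (j : Fin 4) (hj : (X j : S) ∉ pointPrime x) (c : ℂ) :
    dehom x j hj (C c) = fracGerm x (C c) 1 (isHomogeneous_C (Fin 4) c)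
      (isHomogeneous_one (Fin 4) ℂ) (one_notMem_pointPrime x) := by
  simp only [dehom, coe_eval₂Hom, eval₂_C]
  rfl

theorem dehom_of_isHomogeneous (x : P3) (j : Fin 4) (hj : (X j : S) ∉ pointPrime x) {n : ℕ} {G : S}
    (hG : G.IsHomogeneous n) :
    dehom x j hj G = fracGerm x G (X j ^ n) hG (isHomogeneous_X_pow j n) (X_pow_notMem hj n) := by
  apply stalkToLocalization_injective
  rw [stalkToLocalization_fracGerm, Localization.mk_eq_mk', IsLocalization.eq_mk'_iff_mul_eq]
  refine Eq.trans (congrArg (stalkToLocalization x (dehom x j hj G) * ·) (map_pow _ (X j) n)) ?_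
  refine map_mul_pow_of_isHomogeneous ((stalkToLocalization x).comp (dehom x j hj))
    (algebraMap S (Localization.AtPrime (pointPrime x))) (fun c ↦ ?_) (fun i ↦ ?_) hG
  · rw [RingHom.comp_apply, dehom_C, stalkToLocalization_fracGerm]
    exact Localization.mk_one_eq_algebraMap _
  · rw [RingHom.comp_apply, dehom_X, stalkToLocalization_fracGerm, Localization.mk_eq_mk',
      IsLocalization.mk'_spec (M := (pointPrime x).primeCompl) _ _ ⟨X j, hj⟩]

theorem isUnit_dehom_iff (x : P3) (j : Fin 4) (hj : (X j : S) ∉ pointPrime x) {n : ℕ} {G : S}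
    (hG : G.IsHomogeneous n) : IsUnit (dehom x j hj G) ↔ G ∉ pointPrime x := by
  rw [dehom_of_isHomogeneous x j hj hG, isUnit_fracGerm_iff]

theorem dehom_X_self (x : P3) (j : Fin 4) (hj : (X j : S) ∉ pointPrime x) :
    dehom x j hj (X j) = 1 := by
  apply stalkToLocalization_injective
  rw [dehom_X, stalkToLocalization_fracGerm, map_one]
  exact Localization.mk_self (⟨X j, hj⟩ : (pointPrime x).primeCompl)

theorem dehom_X_mul_dehom_X (x : P3) (i j k : Fin 4) (hi : (X i : S) ∉ pointPrime x)
    (hj : (X j : S) ∉ pointPrime x) :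
    dehom x j hj (X i) * dehom x i hi (X k) = dehom x j hj (X k) := by
  apply stalkToLocalization_injective
  rw [map_mul, dehom_X, dehom_X, dehom_X, stalkToLocalization_fracGerm,
    stalkToLocalization_fracGerm, stalkToLocalization_fracGerm, Localization.mk_mul,
    Localization.mk_eq_mk_iff, Localization.r_iff_exists]
  refine ⟨1, ?_⟩
  simp only [Submonoid.coe_mul, OneMemClass.coe_one]
  ring

theorem stalkSpecializes_dehom {x x' : P3} (h : x' ⤳ x) (j : Fin 4)
    (hj : (X j : S) ∉ pointPrime x) (hj' : (X j : S) ∉ pointPrime x') (G : S) :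
    P3.presheaf.stalkSpecializes h (dehom x j hj G) = dehom x' j hj' G := by
  have : (P3.presheaf.stalkSpecializes h).hom.comp (dehom x j hj) = dehom x' j hj' := by
    refine ringHom_ext (fun c ↦ ?_) fun i ↦ ?_
    · rw [RingHom.comp_apply, dehom_C, dehom_C]
      exact stalkSpecializes_fracGerm h _ _ _ _ _ _
    · rw [RingHom.comp_apply, dehom_X, dehom_X]
      exact stalkSpecializes_fracGerm h _ _ _ _ _ _
  exact DFunLike.congr_fun this G

theorem exists_mul_dehom_eq (x : P3) (j : Fin 4) (hj : (X j : S) ∉ pointPrime x)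
    (s : P3.presheaf.stalk x) :
    ∃ (n : ℕ) (G H : S), G.IsHomogeneous n ∧ IsUnit (dehom x j hj H) ∧
      s * dehom x j hj H = dehom x j hj G := by
  obtain ⟨n, G, H, hG, hH, hx, rfl⟩ := exists_eq_fracGerm x s
  refine ⟨n, G, H, hG, (isUnit_dehom_iff x j hj hH).2 hx, ?_⟩
  apply stalkToLocalization_injective
  rw [map_mul, dehom_of_isHomogeneous x j hj hG, dehom_of_isHomogeneous x j hj hH,
    stalkToLocalization_fracGerm,
    stalkToLocalization_fracGerm, stalkToLocalization_fracGerm, Localization.mk_mul,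
    Localization.mk_eq_mk_iff, Localization.r_iff_exists]
  refine ⟨1, ?_⟩
  simp only [Submonoid.coe_mul, OneMemClass.coe_one]
  ring

theorem pointPrime_le_of_specializes {x x' : P3} (h : x' ⤳ x) : pointPrime x' ≤ pointPrime x :=
  (ProjectiveSpectrum.le_iff_mem_closure (𝒜 := homogeneousSubmodule (Fin 4) ℂ) x' x).2
    h.mem_closure

theorem mem_pointPrime_point {a : Fin 4 → ℂ} {ha : a ≠ 0} {G : S} :
    G ∈ pointPrime (point a ha) ↔ evalLine a G = 0 := Iff.rfl

theorem mem_pointPrime_of_mem {s : Set S} {G : S} (hG : G ∈ s) (z : variety s) :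
    G ∈ pointPrime ((idealSheaf s).subschemeι z) := by
  have hr : Set.range (idealSheaf s).subschemeι = (zeroLocus s : Set P3) := by
    rw [Scheme.IdealSheafData.range_subschemeι, idealSheaf,
      Scheme.IdealSheafData.coe_support_vanishingIdeal]
  exact hr.subset ⟨z, rfl⟩ hG

theorem exists_X_notMem_pointPrime (x : P3) : ∃ j, (X j : S) ∉ pointPrime x := by
  by_contra! h
  refine ProjectiveSpectrum.not_irrelevant_le (𝒜 := homogeneousSubmodule (Fin 4) ℂ) x ?_
  intro G hG
  have hG' : G ∈ HomogeneousIdeal.irrelevant (homogeneousSubmodule (Fin 4) ℂ) := hG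
  rw [HomogeneousIdeal.mem_irrelevant_iff, GradedRing.proj_apply] at hG'
  have hc : (DirectSum.decompose (homogeneousSubmodule (Fin 4) ℂ) G 0 : S) =
      homogeneousComponent 0 G := decomposition.decompose'_apply G 0
  rw [hc, homogeneousComponent_zero, C_eq_zero] at hG'
  change G ∈ pointPrime x
  have hle : Ideal.span (Set.range (X : Fin 4 → S)) ≤ pointPrime x := by
    rw [Ideal.span_le]
    rintro _ ⟨j, rfl⟩
    exact h j
  refine hle ?_
  rw [← Set.image_univ, mem_ideal_span_X_image]
  intro m hm
  by_contra! h0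
  have : m = 0 := Finsupp.ext fun i ↦ h0 i (Set.mem_univ i)
  rw [this, mem_support_iff] at hm
  exact hm hG'

theorem X_notMem_of_forall_ne {x : P3} {j : Fin 4} (hx : ∀ k ≠ j, (X k : S) ∈ pointPrime x) :
    (X j : S) ∉ pointPrime x := by
  intro h
  obtain ⟨l, hl⟩ := exists_X_notMem_pointPrime x
  by_cases hlj : l = j
  · exact hl (hlj ▸ h)
  · exact hl (hx l hlj)

/-- Modulo the other coordinates G is G(eⱼ)·Xⱼⁿ, with eⱼ the j-th unit vector, and Xⱼ is not in the
prime. So the prime is determined, and the vanishing of three coordinates singles out one point even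
among non-closed points. -/
theorem mem_pointPrime_iff_eval {x : P3} {j : Fin 4}
    (hx : ∀ k ≠ j, (X k : S) ∈ pointPrime x) {n : ℕ} {G : S} (hG : G.IsHomogeneous n) :
    G ∈ pointPrime x ↔ eval (Pi.single j 1 : Fin 4 → ℂ) G = 0 := by
  let φ : S →+* S := ((Polynomial.aeval (R := ℂ) (X j : S)).comp
    (evalLine (Pi.single j 1))).toRingHom
  have h := sub_mem_of_X φ (pointPrime x) (fun c ↦ ?_) (fun i ↦ ?_) G
  · have hφ : φ G = C (eval (Pi.single j 1 : Fin 4 → ℂ) G) * X j ^ n := by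
      change Polynomial.aeval (X j : S) (evalLine _ G) = _
      rw [evalLine_of_isHomogeneous _ hG]
      simp
    rw [hφ] at h
    rw [← Ideal.neg_mem_iff (pointPrime x)] 
    constructor
    · intro hm
      by_contra hc
      have h2 : C (eval (Pi.single j 1 : Fin 4 → ℂ) G) * X j ^ n ∈ pointPrime x := by
        have := add_mem h hm
        rw [← Ideal.neg_mem_iff] at this
        convert this using 1
        ring
      refine X_pow_notMem (X_notMem_of_forall_ne hx) n ((Ideal.unit_mul_mem_iff_mem _ ?_).1 h2)
      exact (IsUnit.mk0 _ hc).map C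
    · intro h0
      rw [h0] at h
      rw [Ideal.neg_mem_iff]
      simpa using h
  · change Polynomial.aeval (X j : S) (evalLine _ (C c)) = _
    simp [evalLine]
  · change X i - Polynomial.aeval (X j : S) (evalLine _ (X i)) ∈ _
    by_cases h : i = j
    · subst h; simp [evalLine]
    · simpa [evalLine, h] using hx i h

theorem eq_of_X_mem_pointPrime {x y : P3} {j : Fin 4}
    (hx : ∀ k ≠ j, (X k : S) ∈ pointPrime x) (hy : ∀ k ≠ j, (X k : S) ∈ pointPrime y) : x = y := by
  refine ProjectiveSpectrum.ext (HomogeneousIdeal.ext' fun n G hG ↦ ?_)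
  exact (mem_pointPrime_iff_eval hx hG).trans (mem_pointPrime_iff_eval hy hG).symm

/-! ### Coordinates in the local rings of a scheme over ℙ³ -/

section

variable {Z : Scheme.{0}} (i : Z ⟶ P3) (z : Z)

/-- Dehomogenization with values in the local ring of a scheme over `ℙ³`. -/
def coordHom (j : Fin 4) (hj : (X j : S) ∉ pointPrime (i z)) : S →+* Z.presheaf.stalk z :=
  (i.stalkMap z).hom.comp (dehom (i z) j hj)

variable {z} {j : Fin 4} (hj : (X j : S) ∉ pointPrime (i z))

theorem isUnit_coordHom_iff {n : ℕ} {G : S} (hG : G.IsHomogeneous n) :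
    IsUnit (coordHom i z j hj G) ↔ G ∉ pointPrime (i z) := by
  rw [← isUnit_dehom_iff (i z) j hj hG]
  exact isUnit_map_iff (i.stalkMap z).hom _

theorem coordHom_X_self : coordHom i z j hj (X j) = 1 := by
  rw [coordHom, RingHom.comp_apply, dehom_X_self, map_one]

theorem coordHom_X_mul_coordHom_X {k : Fin 4} (hk : (X k : S) ∉ pointPrime (i z)) (l : Fin 4) :
    coordHom i z j hj (X k) * coordHom i z k hk (X l) = coordHom i z j hj (X l) := by
  rw [coordHom, coordHom, RingHom.comp_apply, RingHom.comp_apply, RingHom.comp_apply, ← map_mul,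
    dehom_X_mul_dehom_X]

theorem isUnit_coordHom_C {c : ℂ} (hc : c ≠ 0) : IsUnit (coordHom i z j hj (C c)) :=
  (IsUnit.mk0 c hc).map ((coordHom i z j hj).comp C)

theorem stalkSpecializes_coordHom {z' : Z} (h : z' ⤳ z) (hj' : (X j : S) ∉ pointPrime (i z'))
    (G : S) : Z.presheaf.stalkSpecializes h (coordHom i z j hj G) = coordHom i z' j hj' G := by
  refine (Scheme.Hom.stalkSpecializes_stalkMap_apply i z' z h (dehom (i z) j hj G)).symm.trans ?_
  exact congrArg (i.stalkMap z') (stalkSpecializes_dehom _ j hj hj' G)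

theorem coordHom_mem_maximalIdeal {k : Fin 4} (hk : (X k : S) ∈ pointPrime (i z)) :
    coordHom i z j hj (X k) ∈ IsLocalRing.maximalIdeal (Z.presheaf.stalk z) := fun hu ↦
  (isUnit_coordHom_iff i hj (isHomogeneous_X ℂ k)).1 hu hk

theorem eq_of_coordinate_point [IsClosedImmersion i] {z' : Z}
    (hz : ∀ k ≠ j, (X k : S) ∈ pointPrime (i z))
    (hz' : ∀ k ≠ j, (X k : S) ∈ pointPrime (i z')) : z = z' :=
  i.isClosedEmbedding.injective (eq_of_X_mem_pointPrime hz hz')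

/-- A germ times a unit is the dehomogenization of a form G. Modulo the ratios Xₖ/Xⱼ this is the
constant G(eⱼ), which is 0 when the germ lies in the maximal ideal. -/
theorem maximalIdeal_eq_span_coordHom [IsClosedImmersion i]
    (hz : ∀ k ≠ j, (X k : S) ∈ pointPrime (i z)) :
    IsLocalRing.maximalIdeal (Z.presheaf.stalk z) =
      Ideal.span ((fun k ↦ coordHom i z j hj (X k)) '' {k | k ≠ j}) := by
  have hle : Ideal.span ((fun k ↦ coordHom i z j hj (X k)) '' {k | k ≠ j}) ≤
      IsLocalRing.maximalIdeal (Z.presheaf.stalk z) := by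
    rw [Ideal.span_le]
    rintro _ ⟨k, hk, rfl⟩
    rw [SetLike.mem_coe, IsLocalRing.mem_maximalIdeal, mem_nonunits_iff,
      isUnit_coordHom_iff i hj (isHomogeneous_X ℂ k)]
    exact fun h ↦ h (hz k hk)
  refine le_antisymm (fun s hs ↦ ?_) hle
  set I := Ideal.span ((fun k ↦ coordHom i z j hj (X k)) '' {k | k ≠ j}) with hI
  have hsurj : Function.Surjective (i.stalkMap z).hom := i.stalkMap_surjective z
  obtain ⟨s', rfl⟩ := hsurj s
  obtain ⟨n, G, H, -, hH, h⟩ := exists_mul_dehom_eq (i z) j hj s'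
  have h' : (i.stalkMap z).hom s' * coordHom i z j hj H = coordHom i z j hj G := by
    rw [coordHom, RingHom.comp_apply, RingHom.comp_apply, ← map_mul, h]
  have hH' : IsUnit (coordHom i z j hj H) := hH.map (i.stalkMap z).hom
  rw [← Ideal.mul_unit_mem_iff_mem I hH', h']
  have hG := Ideal.mul_mem_right (coordHom i z j hj H) _ hs
  rw [h'] at hG
  have heq : (Ideal.Quotient.mk I).comp (coordHom i z j hj) =
      (Ideal.Quotient.mk I).comp ((coordHom i z j hj).comp (C.comp (eval (Pi.single j 1)))) := by
    refine ringHom_ext (fun c ↦ by simp) fun k ↦ ?_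
    by_cases hk : k = j
    · subst hk
      simp [coordHom_X_self]
    · simp only [RingHom.comp_apply, eval_X, Pi.single_apply, if_neg hk, map_zero]
      exact Ideal.Quotient.eq_zero_iff_mem.2 (Ideal.subset_span ⟨k, hk, rfl⟩)
  have hsub : coordHom i z j hj G - coordHom i z j hj (C (eval (Pi.single j 1) G)) ∈ I :=
    Ideal.Quotient.eq.1 (DFunLike.congr_fun heq G)
  have hc : coordHom i z j hj (C (eval (Pi.single j 1) G)) ∈
      IsLocalRing.maximalIdeal (Z.presheaf.stalk z) := by
    simpa using sub_mem hG (hle hsub)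
  have h0 : eval (Pi.single j 1) G = 0 := by
    by_contra hne
    exact hc (isUnit_coordHom_C i hj hne)
  simpa [h0] using hsub

variable [IsIntegral Z]

theorem X_notMem_genericPoint (hj : (X j : S) ∉ pointPrime (i z)) :
    (X j : S) ∉ pointPrime (i (genericPoint Z)) := fun h ↦
  hj (pointPrime_le_of_specializes ((genericPoint_specializes z).map i.continuous) h)

theorem algebraMap_coordHom (G : S) :
    algebraMap (Z.presheaf.stalk z) Z.functionField (coordHom i z j hj G) =
      coordHom i (genericPoint Z) j (X_notMem_genericPoint i hj) G :=
  stalkSpecializes_coordHom i hj (genericPoint_specializes z) _ G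

/-- The local ring embeds in the function field, where being nonzero and being a unit agree. -/
theorem coordHom_eq_zero_iff {n : ℕ} {G : S} (hG : G.IsHomogeneous n) :
    coordHom i z j hj G = 0 ↔ G ∈ pointPrime (i (genericPoint Z)) := by
  have hinj : Function.Injective (algebraMap (Z.presheaf.stalk z) Z.functionField) :=
    IsFractionRing.injective _ _
  rw [← map_eq_zero_iff _ hinj, algebraMap_coordHom, ← not_iff_not]
  exact (isUnit_iff_ne_zero (G₀ := Z.functionField)).symm.trans (isUnit_coordHom_iff i _ hG)

end

section

variable {Z : Scheme.{0}} [IsIntegral Z] (i : Z ⟶ P3)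

/-- The rational function `x_k / x_1`. -/
def ratio (h : (X 1 : S) ∉ pointPrime (i (genericPoint Z))) (k : Fin 4) : Z.functionField :=
  coordHom i (genericPoint Z) 1 h (X k)

variable (h : (X 1 : S) ∉ pointPrime (i (genericPoint Z)))

theorem ratio_one : ratio i h 1 = 1 := coordHom_X_self i h

theorem ratio_eq_mul {z : Z} {j : Fin 4} (hj : (X j : S) ∉ pointPrime (i z)) (k : Fin 4) :
    ratio i h k = ratio i h j *
      algebraMap (Z.presheaf.stalk z) Z.functionField (coordHom i z j hj (X k)) := by
  rw [algebraMap_coordHom]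
  exact (coordHom_X_mul_coordHom_X i h _ k).symm

theorem ratio_mul_eq_one {z : Z} {j : Fin 4} (hj : (X j : S) ∉ pointPrime (i z)) :
    ratio i h j * algebraMap (Z.presheaf.stalk z) Z.functionField (coordHom i z j hj (X 1)) = 1 := by
  rw [← ratio_eq_mul, ratio_one]

theorem ratio_eq {z : Z} (hz : (X 1 : S) ∉ pointPrime (i z)) (k : Fin 4) :
    ratio i h k = algebraMap (Z.presheaf.stalk z) Z.functionField (coordHom i z 1 hz (X k)) := by
  rw [ratio_eq_mul i h hz, ratio_one, one_mul]

theorem ratio_ne_zero {k : Fin 4} (hk : (X k : S) ∉ pointPrime (i (genericPoint Z))) :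
    ratio i h k ≠ 0 :=
  (isUnit_iff_ne_zero (G₀ := Z.functionField)).1
    ((isUnit_coordHom_iff i h (isHomogeneous_X ℂ k)).2 hk)

variable {t : ℂ} {z : Z} {j : Fin 4} (hj : (X j : S) ∉ pointPrime (i z))

theorem coordHom_F_eq_zero (hF : F t ∈ pointPrime (i (genericPoint Z))) :
    coordHom i z j hj (X 0) * coordHom i z j hj (X 1) ^ 4 +
      coordHom i z j hj (X 1) * coordHom i z j hj (X 2) ^ 4 +
      coordHom i z j hj (X 2) * coordHom i z j hj (X 0) ^ 4 + coordHom i z j hj (X 3) ^ 5 +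
      coordHom i z j hj (C t) * coordHom i z j hj (X 3) * coordHom i z j hj (X 1) ^ 4 = 0 := by
  have := (coordHom_eq_zero_iff i hj (F_isHomogeneous t)).2 hF
  simpa only [F, map_add, map_mul, map_pow] using this

end

/-! ### Where the coordinates can vanish on the curves -/

section

variable {x : P3} {t : ℂ}

theorem X_mem_or_of_F_mem (hF : F t ∈ pointPrime x) (h0 : (X 0 : S) ∈ pointPrime x)
    (h3 : (X 3 : S) ∈ pointPrime x) : (X 1 : S) ∈ pointPrime x ∨ (X 2 : S) ∈ pointPrime x := by
  have h : X 1 * X 2 ^ 4 ∈ pointPrime x := by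
    have e : X 1 * X 2 ^ 4 = F t - (X 1 ^ 4 + X 2 * X 0 ^ 3) * X 0 -
        (X 3 ^ 4 + C t * X 1 ^ 4) * X 3 := by rw [F]; ring
    rw [e]
    exact sub_mem (sub_mem hF (Ideal.mul_mem_left _ _ h0)) (Ideal.mul_mem_left _ _ h3)
  exact (Ideal.IsPrime.mem_or_mem inferInstance h).imp_right
    (Ideal.IsPrime.mem_of_pow_mem inferInstance 4)

theorem X_mem_or_of_F_mem' (hF : F t ∈ pointPrime x) (h2 : (X 2 : S) ∈ pointPrime x)
    (h3 : (X 3 : S) ∈ pointPrime x) : (X 0 : S) ∈ pointPrime x ∨ (X 1 : S) ∈ pointPrime x := by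
  have h : X 0 * X 1 ^ 4 ∈ pointPrime x := by
    have e : X 0 * X 1 ^ 4 = F t - (X 1 * X 2 ^ 3 + X 0 ^ 4) * X 2 -
        (X 3 ^ 4 + C t * X 1 ^ 4) * X 3 := by rw [F]; ring
    rw [e]
    exact sub_mem (sub_mem hF (Ideal.mul_mem_left _ _ h2)) (Ideal.mul_mem_left _ _ h3)
  exact (Ideal.IsPrime.mem_or_mem inferInstance h).imp_right
    (Ideal.IsPrime.mem_of_pow_mem inferInstance 4)

theorem X_mem_or_of_F_mem'' (hF : F t ∈ pointPrime x) (h1 : (X 1 : S) ∈ pointPrime x)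
    (h3 : (X 3 : S) ∈ pointPrime x) : (X 2 : S) ∈ pointPrime x ∨ (X 0 : S) ∈ pointPrime x := by
  have h : X 2 * X 0 ^ 4 ∈ pointPrime x := by
    have e : X 2 * X 0 ^ 4 = F t - (X 0 * X 1 ^ 3 + X 2 ^ 4) * X 1 -
        (X 3 ^ 4 + C t * X 1 ^ 4) * X 3 := by rw [F]; ring
    rw [e]
    exact sub_mem (sub_mem hF (Ideal.mul_mem_left _ _ h1)) (Ideal.mul_mem_left _ _ h3)
  exact (Ideal.IsPrime.mem_or_mem inferInstance h).imp_right
    (Ideal.IsPrime.mem_of_pow_mem inferInstance 4)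

theorem X_three_mem_of_F_mem (hF : F t ∈ pointPrime x) (h0 : (X 0 : S) ∈ pointPrime x)
    (h1 : (X 1 : S) ∈ pointPrime x) : (X 3 : S) ∈ pointPrime x := by
  have h : X 3 ^ 5 ∈ pointPrime x := by
    have e : X 3 ^ 5 = F t - (X 1 ^ 4 + X 2 * X 0 ^ 3) * X 0 -
        (X 2 ^ 4 + C t * X 3 * X 1 ^ 3) * X 1 := by rw [F]; ring
    rw [e]
    exact sub_mem (sub_mem hF (Ideal.mul_mem_left _ _ h0)) (Ideal.mul_mem_left _ _ h1)
  exact Ideal.IsPrime.mem_of_pow_mem inferInstance 5 h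

end

/-! ### The divisors of the two functions -/

section

variable {Z : Scheme.{0}} [IsIntegral Z] (i : Z ⟶ P3) [IsClosedImmersion i] {t : ℂ} {P Q : Z}

theorem isUnit_one_add {R : Type*} [CommRing R] [IsLocalRing R] {x : R}
    (hx : x ∈ IsLocalRing.maximalIdeal R) : IsUnit (1 + x) := by
  by_contra h
  have := sub_mem ((IsLocalRing.mem_maximalIdeal _).2 h) hx
  rw [add_sub_cancel_right] at this
  exact this isUnit_one

theorem ord_mul_pow_of_isUnit {R : Type*} [CommRing R] [IsDomain R] [IsNoetherianRing R] [IsLocalRing R]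
    {u x : R} (hu : IsUnit u) (hx : x ≠ 0) {m : ℕ} (h1 : Ring.ord R x = m) (n : ℕ) :
    Ring.ord R (u * x ^ n) = (n * m : ℕ) := by
  rw [Ring.ord_mul_of_isUnit_left hu, Ring.ord_pow (mem_nonZeroDivisors_of_ne_zero hx), h1]
  simp

theorem forall_ne_one_iff {p : Fin 4 → Prop} : (∀ k ≠ 1, p k) ↔ p 0 ∧ p 2 ∧ p 3 := by
  simp [Fin.forall_fin_succ]

theorem forall_ne_two_iff {p : Fin 4 → Prop} : (∀ k ≠ 2, p k) ↔ p 0 ∧ p 1 ∧ p 3 := by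
  simp [Fin.forall_fin_succ]

/-- The curve here is x₀x₁⁴ + x₁x₂⁴ + x₂x₀⁴ = 0. Near each coordinate point the equation solves one
ratio as minus the fourth power of another divided by a unit v, so the order of any monomial can be
read off. -/
theorem hasZeroPole_of_X_three_mem [IsLocallyNoetherian Z]
    (hF : F t ∈ pointPrime (i (genericPoint Z)))
    (h3 : (X 3 : S) ∈ pointPrime (i (genericPoint Z)))
    (h : (X 1 : S) ∉ pointPrime (i (genericPoint Z)))
    (hP : ∀ k ≠ 1, (X k : S) ∈ pointPrime (i P)) (hQ : ∀ k ≠ 2, (X k : S) ∈ pointPrime (i Q)) :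
    HasZeroPole ((ratio i h 0 ^ 3 * ratio i h 2) ^ 4) P Q 52 := by
  have hle (z : Z) : pointPrime (i (genericPoint Z)) ≤ pointPrime (i z) :=
    pointPrime_le_of_specializes ((genericPoint_specializes z).map i.continuous)
  have h1P := X_notMem_of_forall_ne hP
  have h2Q := X_notMem_of_forall_ne hQ
  have h2 := X_notMem_genericPoint i h2Q
  have h0 : (X 0 : S) ∉ pointPrime (i (genericPoint Z)) := fun h0 ↦
    (X_mem_or_of_F_mem hF h0 h3).elim h h2
  have hz3 {z : Z} {j : Fin 4} (hj : (X j : S) ∉ pointPrime (i z)) : coordHom i z j hj (X 3) = 0 :=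
    (coordHom_eq_zero_iff i hj (isHomogeneous_X ℂ 3)).2 h3
  have hne {z : Z} {j k : Fin 4} (hj : (X j : S) ∉ pointPrime (i z))
      (hk : (X k : S) ∉ pointPrime (i (genericPoint Z))) : coordHom i z j hj (X k) ≠ 0 := fun h' ↦
    hk ((coordHom_eq_zero_iff i hj (isHomogeneous_X ℂ k)).1 h')
  refine ⟨?_, ?_, fun z hzP hzQ ↦ ?_⟩
  · have hF' := coordHom_F_eq_zero i h1P hF
    have hm := maximalIdeal_eq_span_coordHom i h1P hP
    have hm0 := coordHom_mem_maximalIdeal i h1P (hP 2 (by decide))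
    have hn2 := hne h1P h2
    rw [ratio_eq i h h1P, ratio_eq i h h1P]
    rw [coordHom_X_self, hz3 h1P] at hF'
    have hi : {k : Fin 4 | k ≠ 1} = {0, 2, 3} := by ext k; fin_cases k <;> simp
    rw [hi, Set.image_insert_eq, Set.image_pair, hz3 h1P] at hm
    set a := coordHom i P 1 h1P (X 0)
    set b := coordHom i P 1 h1P (X 2)
    obtain ⟨v, hv⟩ := isUnit_one_add (Ideal.mul_mem_right (a ^ 3) _ hm0)
    have ha : a = -(b ^ 4 * ↑v⁻¹) := by
      have : a * ↑v = -b ^ 4 := by rw [hv]; linear_combination hF'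
      rw [← Units.mul_inv_cancel_right a v, this]; ring
    have hb : IsLocalRing.maximalIdeal (Z.presheaf.stalk P) = Ideal.span {b} := by
      rw [hm]
      refine le_antisymm (Ideal.span_le.2 ?_) (Ideal.span_mono (by simp))
      rintro _ (rfl | rfl | rfl)
      · rw [SetLike.mem_coe, Ideal.mem_span_singleton, ha]
        exact ⟨-(b ^ 3 * ↑v⁻¹), by ring⟩
      · exact Ideal.mem_span_singleton_self _
      · exact zero_mem _
    refine ⟨(a ^ 3 * b) ^ 4, by simp only [map_mul, map_pow], ?_⟩
    -- From a = -b⁴/v, the product a³b is -b¹³/v³; the outer fourth power removes the sign and gives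
    -- 52 = 4·13.
    have e : (a ^ 3 * b) ^ 4 = (v⁻¹ ^ 12 : (Z.presheaf.stalk P)ˣ) * b ^ 52 := by
      push_cast
      rw [ha]; ring
    rw [e, ord_mul_pow_of_isUnit (Units.isUnit _) hn2 (m := 1)
      (by simpa using Ring.ord_eq_one_of_maximalIdeal hb)]
  · have hF' := coordHom_F_eq_zero i h2Q hF
    have hm := maximalIdeal_eq_span_coordHom i h2Q hQ
    have hm0 := coordHom_mem_maximalIdeal i h2Q (hQ 0 (by decide))
    have hn0 := hne h2Q h0
    have hr := ratio_mul_eq_one i h h2Q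
    rw [ratio_eq_mul i h h2Q 0]
    rw [coordHom_X_self, hz3 h2Q] at hF'
    have hi : {k : Fin 4 | k ≠ 2} = {0, 1, 3} := by ext k; fin_cases k <;> simp
    rw [hi, Set.image_insert_eq, Set.image_pair, hz3 h2Q] at hm
    set a := coordHom i Q 2 h2Q (X 0)
    set b := coordHom i Q 2 h2Q (X 1)
    obtain ⟨v, hv⟩ := isUnit_one_add (Ideal.mul_mem_right (b ^ 3) _ hm0)
    have hb' : b = -(a ^ 4 * ↑v⁻¹) := by
      have : b * ↑v = -a ^ 4 := by rw [hv]; linear_combination hF'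
      rw [← Units.mul_inv_cancel_right b v, this]; ring
    have ha : IsLocalRing.maximalIdeal (Z.presheaf.stalk Q) = Ideal.span {a} := by
      rw [hm]
      refine le_antisymm (Ideal.span_le.2 ?_) (Ideal.span_mono (by simp))
      rintro _ (rfl | rfl | rfl)
      · exact Ideal.mem_span_singleton_self _
      · rw [SetLike.mem_coe, Ideal.mem_span_singleton, hb']
        exact ⟨-(a ^ 3 * ↑v⁻¹), by ring⟩
      · exact zero_mem _
    -- In these coordinates 1/f is b¹⁶/a¹², and b = -a⁴/v turns it into a⁵²/v¹⁶. Multiplying by a¹²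
    -- avoids the denominator in the local ring.
    have e : (v⁻¹ ^ 16 : (Z.presheaf.stalk Q)ˣ) * a ^ 52 * a ^ 12 = b ^ 16 := by
      push_cast
      rw [hb']; ring
    refine ⟨(v⁻¹ ^ 16 : (Z.presheaf.stalk Q)ˣ) * a ^ 52, ?_, ?_⟩
    · refine eq_inv_of_mul_eq_one_left ?_
      have e' := congrArg (algebraMap (Z.presheaf.stalk Q) Z.functionField) e
      rw [map_mul, map_pow, map_pow] at e'
      generalize algebraMap (Z.presheaf.stalk Q) Z.functionField a = a' at *
      generalize algebraMap (Z.presheaf.stalk Q) Z.functionField b = b' at *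
      calc _ = ratio i h 2 ^ 16 * (algebraMap (Z.presheaf.stalk Q) Z.functionField
              ((v⁻¹ ^ 16 : (Z.presheaf.stalk Q)ˣ) * a ^ 52) * a' ^ 12) := by ring
        _ = (ratio i h 2 * b') ^ 16 := by rw [e']; ring
        _ = 1 := by rw [hr, one_pow]
    · rw [ord_mul_pow_of_isUnit (Units.isUnit _) hn0 (m := 1)
        (by simpa using Ring.ord_eq_one_of_maximalIdeal ha)]
  · by_cases hz : (X 1 : S) ∈ pointPrime (i z)
    · by_cases hz2 : (X 2 : S) ∈ pointPrime (i z)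
      -- This is the point (1:0:0:0), where f = (b/a⁴)⁴ and b = -a⁴/v give f = v⁻⁴, a unit.
      · have hz0 : (X 0 : S) ∉ pointPrime (i z) := by
          intro hz0
          obtain ⟨l, hl⟩ := exists_X_notMem_pointPrime (i z)
          have := hle z h3
          fin_cases l <;> exact hl (by assumption)
        have hF' := coordHom_F_eq_zero i hz0 hF
        have hm1 := coordHom_mem_maximalIdeal i hz0 hz
        have hr := ratio_mul_eq_one i h hz0
        rw [ratio_eq_mul i h hz0 2]
        rw [coordHom_X_self, hz3 hz0] at hF'
        set a := coordHom i z 0 hz0 (X 1)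
        set b := coordHom i z 0 hz0 (X 2)
        obtain ⟨v, hv⟩ := isUnit_one_add (Ideal.mul_mem_right (b ^ 3) _ hm1)
        have hb : b = -(a ^ 4 * ↑v⁻¹) := by
          have : b * ↑v = -a ^ 4 := by rw [hv]; linear_combination hF'
          rw [← Units.mul_inv_cancel_right b v, this]; ring
        refine ⟨(v⁻¹ ^ 4 : (Z.presheaf.stalk z)ˣ), ?_, Units.isUnit _⟩
        have e : b ^ 4 = (v⁻¹ ^ 4 : (Z.presheaf.stalk z)ˣ) * a ^ 16 := by
          push_cast
          rw [hb]; ring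
        have e' := congrArg (algebraMap (Z.presheaf.stalk z) Z.functionField) e
        rw [map_mul, map_pow, map_pow] at e'
        generalize algebraMap (Z.presheaf.stalk z) Z.functionField a = a' at *
        generalize algebraMap (Z.presheaf.stalk z) Z.functionField b = b' at *
        symm
        calc _ = ratio i h 0 ^ 16 * b' ^ 4 := by ring
          _ = (ratio i h 0 * a') ^ 16 * algebraMap (Z.presheaf.stalk z) Z.functionField
              (v⁻¹ ^ 4 : (Z.presheaf.stalk z)ˣ) := by rw [e']; ring
          _ = _ := by rw [hr, one_pow, one_mul]
      · refine absurd (eq_of_coordinate_point i (j := 2) (forall_ne_two_iff.2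
          ⟨?_, hz, hle z h3⟩) hQ) hzQ
        exact (X_mem_or_of_F_mem'' (hle z hF) hz (hle z h3)).resolve_left hz2
    · have hz2 : (X 2 : S) ∉ pointPrime (i z) := fun hz2 ↦ hzP
        (eq_of_coordinate_point i (j := 1) (forall_ne_one_iff.2
          ⟨(X_mem_or_of_F_mem' (hle z hF) hz2 (hle z h3)).resolve_right hz, hz2, hle z h3⟩) hP)
      have hz0 : (X 0 : S) ∉ pointPrime (i z) := fun hz0 ↦
        (X_mem_or_of_F_mem (hle z hF) hz0 (hle z h3)).elim hz hz2
      refine ⟨(coordHom i z 1 hz (X 0) ^ 3 * coordHom i z 1 hz (X 2)) ^ 4, ?_, ?_⟩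
      · simp only [map_mul, map_pow, ratio_eq i h hz]
      · exact ((((isUnit_coordHom_iff i hz (isHomogeneous_X ℂ 0)).2 hz0).pow 3).mul
          ((isUnit_coordHom_iff i hz (isHomogeneous_X ℂ 2)).2 hz2)).pow 4

/-- The curve here is x₁x₂⁴ + x₃⁵ + t x₃x₁⁴ = 0, and x₃/x₁ has order 4 at P and 1 - 5 = -4 at Q; the
exponent 13 raises these to 52 and -52. If x₁ vanishes at a point, so does x₃, hence only P and Q
occur. -/
theorem hasZeroPole_of_X_zero_mem [IsLocallyNoetherian Z]
    (hF : F t ∈ pointPrime (i (genericPoint Z)))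
    (h0 : (X 0 : S) ∈ pointPrime (i (genericPoint Z)))
    (h : (X 1 : S) ∉ pointPrime (i (genericPoint Z)))
    (hP : ∀ k ≠ 1, (X k : S) ∈ pointPrime (i P)) (hQ : ∀ k ≠ 2, (X k : S) ∈ pointPrime (i Q)) :
    HasZeroPole (ratio i h 3 ^ 13) P Q 52 := by
  have hle (z : Z) : pointPrime (i (genericPoint Z)) ≤ pointPrime (i z) :=
    pointPrime_le_of_specializes ((genericPoint_specializes z).map i.continuous)
  have h1P := X_notMem_of_forall_ne hP
  have h2Q := X_notMem_of_forall_ne hQ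
  have h2 := X_notMem_genericPoint i h2Q
  have h3 : (X 3 : S) ∉ pointPrime (i (genericPoint Z)) := fun h3 ↦
    (X_mem_or_of_F_mem hF h0 h3).elim h h2
  have hz0 {z : Z} {j : Fin 4} (hj : (X j : S) ∉ pointPrime (i z)) : coordHom i z j hj (X 0) = 0 :=
    (coordHom_eq_zero_iff i hj (isHomogeneous_X ℂ 0)).2 h0
  have hne {z : Z} {j k : Fin 4} (hj : (X j : S) ∉ pointPrime (i z))
      (hk : (X k : S) ∉ pointPrime (i (genericPoint Z))) : coordHom i z j hj (X k) ≠ 0 := fun h' ↦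
    hk ((coordHom_eq_zero_iff i hj (isHomogeneous_X ℂ k)).1 h')
  refine ⟨?_, ?_, fun z hzP hzQ ↦ ?_⟩
  · have hF' := coordHom_F_eq_zero i h1P hF
    have hm := maximalIdeal_eq_span_coordHom i h1P hP
    have hn2 := hne h1P h2
    have hn3 := hne h1P h3
    rw [ratio_eq i h h1P]
    rw [coordHom_X_self, hz0 h1P] at hF'
    have hi : {k : Fin 4 | k ≠ 1} = {0, 3, 2} := by ext k; fin_cases k <;> simp
    rw [hi, Set.image_insert_eq, Set.image_pair, hz0 h1P, Ideal.span_insert_zero] at hm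
    refine ⟨coordHom i P 1 h1P (X 3) ^ 13, map_pow _ _ _, ?_⟩
    -- The case split is between the singular point (t = 0) and the smooth one; `Ring.ord_eq_four`
    -- treats both.
    have ht : coordHom i P 1 h1P (C t) = 0 ∨ IsUnit (coordHom i P 1 h1P (C t)) := by
      by_cases ht : t = 0
      · left; rw [ht, map_zero, map_zero]
      · exact .inr (isUnit_coordHom_C i h1P ht)
    have h4 := Ring.ord_eq_four hm hn3 hn2 (by linear_combination hF') ht
    rw [← one_mul (coordHom i P 1 h1P (X 3) ^ 13),
      ord_mul_pow_of_isUnit isUnit_one hn3 (m := 4) (by simpa using h4)]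
  · have hF' := coordHom_F_eq_zero i h2Q hF
    have hm := maximalIdeal_eq_span_coordHom i h2Q hQ
    have hm3 := coordHom_mem_maximalIdeal i h2Q (hQ 3 (by decide))
    have hn3 := hne h2Q h3
    have hr := ratio_mul_eq_one i h h2Q
    rw [ratio_eq_mul i h h2Q 3]
    rw [coordHom_X_self, hz0 h2Q] at hF'
    have hi : {k : Fin 4 | k ≠ 2} = {0, 1, 3} := by ext k; fin_cases k <;> simp
    rw [hi, Set.image_insert_eq, Set.image_pair, hz0 h2Q, Ideal.span_insert_zero] at hm
    set a := coordHom i Q 2 h2Q (X 3)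
    set b := coordHom i Q 2 h2Q (X 1)
    obtain ⟨v, hv⟩ := isUnit_one_add
      (Ideal.mul_mem_right (coordHom i Q 2 h2Q (C t) * b ^ 3) _ hm3)
    have hb' : b = -(a ^ 5 * ↑v⁻¹) := by
      have : b * ↑v = -a ^ 5 := by rw [hv]; linear_combination hF'
      rw [← Units.mul_inv_cancel_right b v, this]; ring
    have ha : IsLocalRing.maximalIdeal (Z.presheaf.stalk Q) = Ideal.span {a} := by
      rw [hm]
      refine le_antisymm (Ideal.span_le.2 ?_) (Ideal.span_mono (by simp))
      rintro _ (rfl | rfl)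
      · rw [SetLike.mem_coe, Ideal.mem_span_singleton, hb']
        exact ⟨-(a ^ 4 * ↑v⁻¹), by ring⟩
      · exact Ideal.mem_span_singleton_self _
    -- Here 1/f is (b/a)¹³ and b = -a⁵/v, so 1/f is a⁵² times a unit. The sign stays, as 13 is odd.
    have e : ((-v⁻¹) ^ 13 : (Z.presheaf.stalk Q)ˣ) * a ^ 52 * a ^ 13 = b ^ 13 := by
      push_cast
      rw [hb']; ring
    refine ⟨((-v⁻¹) ^ 13 : (Z.presheaf.stalk Q)ˣ) * a ^ 52, ?_, ?_⟩
    · refine eq_inv_of_mul_eq_one_left ?_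
      have e' := congrArg (algebraMap (Z.presheaf.stalk Q) Z.functionField) e
      rw [map_mul, map_pow, map_pow] at e'
      generalize algebraMap (Z.presheaf.stalk Q) Z.functionField a = a' at *
      generalize algebraMap (Z.presheaf.stalk Q) Z.functionField b = b' at *
      calc _ = ratio i h 2 ^ 13 * (algebraMap (Z.presheaf.stalk Q) Z.functionField
              (((-v⁻¹) ^ 13 : (Z.presheaf.stalk Q)ˣ) * a ^ 52) * a' ^ 13) := by ring
        _ = (ratio i h 2 * b') ^ 13 := by rw [e']; ring
        _ = 1 := by rw [hr, one_pow]
    · rw [ord_mul_pow_of_isUnit (Units.isUnit _) hn3 (m := 1)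
        (by simpa using Ring.ord_eq_one_of_maximalIdeal ha)]
  · by_cases hz : (X 1 : S) ∈ pointPrime (i z)
    · exact absurd (eq_of_coordinate_point i (j := 2) (forall_ne_two_iff.2
          ⟨hle z h0, hz, X_three_mem_of_F_mem (hle z hF) (hle z h0) hz⟩) hQ) hzQ
    · have hz3 : (X 3 : S) ∉ pointPrime (i z) := fun hz3 ↦ hzP
        (eq_of_coordinate_point i (j := 1) (forall_ne_one_iff.2 ⟨hle z h0,
          (X_mem_or_of_F_mem (hle z hF) (hle z h0) hz3).resolve_left hz, hz3⟩) hP)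
      exact ⟨coordHom i z 1 hz (X 3) ^ 13, by rw [map_pow, ratio_eq i h hz],
        ((isUnit_coordHom_iff i hz (isHomogeneous_X ℂ 3)).2 hz3).pow 13⟩

end

/-! ### Dimension of ℙ³ and of X_t; irreducibility of X_t -/

theorem exists_surjective_away (j : Fin 4) :
    ∃ φ : S →+* HomogeneousLocalization.Away (homogeneousSubmodule (Fin 4) ℂ) (X j : S),
      Function.Surjective φ ∧ φ (X j) = 1 := by
  let 𝒜 := homogeneousSubmodule (Fin 4) ℂ
  have hX (i : Fin 4) : (X i : S) ∈ 𝒜 1 := isHomogeneous_X ℂ i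
  let φ : S →+* HomogeneousLocalization.Away 𝒜 (X j : S) :=
    eval₂Hom ((HomogeneousLocalization.fromZeroRingHom 𝒜 _).comp (algebraMap ℂ (𝒜 0)))
      fun i ↦ HomogeneousLocalization.Away.mk 𝒜 (hX j) 1 (X i) (hX i)
  let ψ := algebraMap (HomogeneousLocalization.Away 𝒜 (X j : S))
    (Localization.Away (X j : S))
  have hψ : Function.Injective ψ := HomogeneousLocalization.val_injective _
  have hφX (i : Fin 4) : ψ (φ (X i)) =
      Localization.mk (X i) (⟨X j ^ 1, 1, rfl⟩ : Submonoid.powers (X j : S)) := by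
    simp only [φ, coe_eval₂Hom, eval₂_X]
    rfl
  refine ⟨φ, fun s ↦ ?_, hψ ?_⟩
  · obtain ⟨n, G, hG, rfl⟩ := HomogeneousLocalization.Away.mk_surjective 𝒜 (hX j) s
    have hG' : G.IsHomogeneous n := by simpa [𝒜] using hG
    refine ⟨G, hψ ?_⟩
    refine Eq.trans ?_ (HomogeneousLocalization.Away.val_mk (𝒜 := 𝒜) n (hX j) G hG).symm
    rw [Localization.mk_eq_mk', IsLocalization.eq_mk'_iff_mul_eq]
    refine Eq.trans (congrArg (ψ (φ G) * ·) (map_pow _ (X j) n)) ?_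
    refine map_mul_pow_of_isHomogeneous (ψ.comp φ) (algebraMap S (Localization.Away (X j : S)))
      (fun c ↦ ?_) (fun i ↦ ?_) hG'
    · simp only [RingHom.comp_apply, φ, coe_eval₂Hom, eval₂_C]
      exact Localization.mk_one_eq_algebraMap _
    · rw [RingHom.comp_apply, hφX, Localization.mk_eq_mk']
      simp
  · rw [hφX, map_one]
    simp

theorem exists_affine_chart (x : P3) : ∃ (R : CommRingCat.{0}) (f : Spec R ⟶ P3)
    (_ : IsOpenImmersion f), IsNoetherianRing R ∧ ringKrullDim R ≤ (3 : ℕ) ∧ x ∈ Set.range f := by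
  obtain ⟨j, hj⟩ := exists_X_notMem_pointPrime x
  obtain ⟨φ, hφ, h1⟩ := exists_surjective_away j
  have hX : (X j : S) ∈ homogeneousSubmodule (Fin 4) ℂ 1 := isHomogeneous_X ℂ j
  refine ⟨.of (HomogeneousLocalization.Away (homogeneousSubmodule (Fin 4) ℂ) (X j : S)),
    Proj.awayι _ (X j) hX one_pos, inferInstance, isNoetherianRing_of_surjective _ _ φ hφ, ?_, ?_⟩
  · have hne : (X j - 1 : S) ≠ 0 := by
      intro h
      have := congrArg (eval (0 : Fin 4 → ℂ)) h
      simp at this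
    -- The chart ring is a quotient of the polynomial ring in four variables in which the
    -- nonzerodivisor Xⱼ - 1 dies, so its dimension is at most 3.
    have h := ringKrullDim_succ_le_of_surjective φ hφ (mem_nonZeroDivisors_of_ne_zero hne)
      (by rw [map_sub, h1, map_one, sub_self])
    rw [MvPolynomial.ringKrullDim_of_isNoetherianRing, ringKrullDim_eq_zero_of_field, zero_add,
      Nat.card_fin, show ((4 : ℕ) : WithBot ℕ∞) = (3 : ℕ) + 1 by norm_num] at h
    exact (ENat.WithBot.add_le_add_one_right_iff).1 h
  · have : x ∈ (Proj.awayι (homogeneousSubmodule (Fin 4) ℂ) (X j) hX one_pos).opensRange := by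
      rw [Proj.opensRange_awayι]
      exact hj
    exact this

theorem coheight_P3_le (x : P3) : Order.coheight x ≤ 3 := by
  obtain ⟨R, f, _, _, hR, hx⟩ := exists_affine_chart x
  exact coheight_le_of_openCover f hx hR

theorem coheight_affineSpace_P3_le (y : 𝔸(Fin 1; P3)) : Order.coheight y ≤ 3 + 1 := by
  obtain ⟨R, f, _, _, hR, hx⟩ := exists_affine_chart ((𝔸(Fin 1; P3) ↘ P3) y)
  exact_mod_cast coheight_affineSpace_le f hR y hx

instance : IrreducibleSpace P3 := by
  let η : P3 := 
    { asHomogeneousIdeal := ⊥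
      isPrime := (Ideal.isPrime_bot : (⊥ : Ideal S).IsPrime)
      not_irrelevant_le := by
        intro h
        have hX : (X 0 : S) ∈ HomogeneousIdeal.irrelevant (homogeneousSubmodule (Fin 4) ℂ) := by
          rw [HomogeneousIdeal.mem_irrelevant_iff, GradedRing.proj_apply]
          exact DirectSum.decompose_of_mem_ne _ (isHomogeneous_X ℂ 0) one_ne_zero
        exact X_ne_zero (R := ℂ) (0 : Fin 4) (Ideal.mem_bot.1 (h hX)) }
  have hd : closure {η} = (Set.univ : Set P3) := by
    refine Set.eq_univ_of_forall fun x ↦ ?_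
    exact (ProjectiveSpectrum.le_iff_mem_closure (𝒜 := homogeneousSubmodule (Fin 4) ℂ) η x).1
      (show (⊥ : HomogeneousIdeal (homogeneousSubmodule (Fin 4) ℂ)) ≤
        ProjectiveSpectrum.asHomogeneousIdeal x from bot_le)
  rw [irreducibleSpace_def, Set.top_eq_univ, ← hd]
  exact isIrreducible_singleton.closure

/-- The polynomial ring in `x₀, x₁, x₂`. -/
abbrev B : Type := MvPolynomial (Fin 3) ℂ

/-- Eisenstein for F_t as a monic polynomial in x₃, at the prime (x₁, x₂) of ℂ[x₀, x₁, x₂]. The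
constant term contains x₂x₀⁴, which is linear in x₁, x₂, so it is not in the square of that prime.
-/
theorem prime_F (t : ℂ) : (Ideal.span {F t}).IsPrime := by
  let φ : S →+* Polynomial B := (aeval (R := ℂ)
    ![Polynomial.C (X 0), Polynomial.C (X 1), Polynomial.C (X 2), Polynomial.X]).toRingHom
  let ψ : Polynomial B →+* S := Polynomial.eval₂RingHom
    (aeval (R := ℂ) (![X 0, X 1, X 2] : Fin 3 → S)).toRingHom (X 3)
  let c : B := X 0 * X 1 ^ 4 + X 1 * X 2 ^ 4 + X 2 * X 0 ^ 4
  have hφ : φ (F t) = Polynomial.X ^ 5 + Polynomial.C (C t * X 1 ^ 4) * Polynomial.X +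
      Polynomial.C c := by
    simp [φ, F, c]
    ring
  -- The second generator 0 lets `span_pair_isPrime` apply, with φ now injective.
  have h0 : (Ideal.span {F t, 0}).IsPrime := by
    refine span_pair_isPrime φ ψ _ _ (sub_mem_of_X (ψ.comp φ) _ (fun c ↦ ?_) fun i ↦ ?_)
      (map_zero φ) ?_
    · simp [φ, ψ]
    · fin_cases i <;> simp [φ, ψ]
    generalize φ (F t) = f at hφ ⊢
    have hn : f.natDegree = 5 := by rw [hφ]; compute_degree!
    have c5 : f.coeff 5 = 1 := by simp [hφ, -map_pow, -map_mul]
    have c0 : f.coeff 0 = c := by simp [hφ, -map_mul, -map_pow]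
    have hm : f.Monic := by rw [Polynomial.Monic, Polynomial.leadingCoeff, hn, c5]
    have hf0 : f ≠ 0 := hm.ne_zero
    obtain ⟨d, hd⟩ : ∃ d : B, d = C t * X 1 ^ 4 := ⟨_, rfl⟩
    rw [← hd] at hφ
    let π : B →ₐ[ℂ] Polynomial ℂ := aeval ![Polynomial.X, 0, 0]
    -- `ρ` is the tangent vector in direction x₂ at the point (1, 0, 0): it kills the square of the
    -- kernel of `π`, but sends the constant term `c` to ε.
    let ρ : B →ₐ[ℂ] DualNumber ℂ := aeval ![1, 0, DualNumber.eps]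
    have hρ (b : B) : (ρ b).fst = (π b).eval 1 := by
      have : (TrivSqZeroExt.fstHom ℂ ℂ ℂ).comp ρ = (Polynomial.aeval (1 : ℂ)).comp π := by
        refine algHom_ext fun i ↦ ?_
        fin_cases i <;> simp [ρ, π]
      simpa using DFunLike.congr_fun this b
    rw [Ideal.span_singleton_prime hf0, ← UniqueFactorizationMonoid.irreducible_iff_prime]
    refine Polynomial.irreducible_of_eisenstein_criterion (P := RingHom.ker π) (RingHom.ker_isPrime _) ?_ ?_
      (Polynomial.natDegree_pos_iff_degree_pos.1 (by omega)) ?_ hm.isPrimitive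
    · rw [hm.leadingCoeff]
      simp [RingHom.mem_ker]
    · intro n hn'
      have hn5 : n < 5 := hn ▸ Polynomial.coe_lt_degree.1 hn'
      have h1 : π d = 0 := by simp [hd, π]
      have h2 : π c = 0 := by simp [c, π]
      rw [RingHom.mem_ker, hφ]
      clear_value c
      interval_cases n <;> simp [h1, h2, Polynomial.coeff_X_pow, Polynomial.coeff_C]
    · rw [c0, pow_two]
      intro hc
      have hle : RingHom.ker π * RingHom.ker π ≤ RingHom.ker ρ := by
        rw [Ideal.mul_le]
        intro r hr s hs
        rw [RingHom.mem_ker] at hr hs ⊢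
        have h1 := hρ r
        have h2 := hρ s
        rw [hr, Polynomial.eval_zero] at h1
        rw [hs, Polynomial.eval_zero] at h2
        rw [map_mul]
        ext <;> simp [h1, h2]
      have := congrArg TrivSqZeroExt.snd (RingHom.mem_ker.1 (hle hc))
      simp [c, ρ] at this
  have e : Ideal.span {F t, 0} = Ideal.span {F t} := by
    rw [Set.pair_comm, Ideal.span_insert_zero]
  rwa [e] at h0

theorem X_notMem_span_F (t : ℂ) : (X 1 : S) ∉ Ideal.span {F t} := fun h ↦
  X_one_notMem (t := t) (i := 0) (by decide) (Ideal.span_mono (by simp) h)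

instance (t : ℂ) : IrreducibleSpace (surface t) :=
  irreducibleSpace_variety (prime_F t)
    (Ideal.homogeneous_span _ _ (by rintro _ rfl; exact ⟨5, F_isHomogeneous t⟩))
    ⟨1, X_notMem_span_F t⟩

theorem exists_notMem_range_subschemeι (t : ℂ) :
    ∃ x : P3, x ∉ Set.range (idealSheaf {F t}).subschemeι := by
  -- Here F_t takes the value 1.
  refine ⟨point ![0, 0, 0, 1] (fun h ↦ by simpa using congrFun h 3), ?_⟩
  rintro ⟨z, hz⟩
  have := mem_pointPrime_of_mem (s := {F t}) rfl z
  rw [hz, mem_pointPrime_point] at this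
  simp [F, evalLine] at this

theorem coheight_surface_le (t : ℂ) (x : surface t) : Order.coheight x ≤ 2 := by
  obtain ⟨b, hb⟩ := exists_notMem_range_subschemeι t
  have h := (coheight_add_one_le_of_isClosedImmersion _ hb x).trans (coheight_P3_le _)
  rw [show (3 : ℕ∞) = 2 + 1 by norm_num] at h
  exact (ENat.add_le_add_iff_right (by simp)).1 h

theorem coheight_affineSpace_surface_le (t : ℂ) (y : 𝔸(Fin 1; surface t)) :
    Order.coheight y ≤ 3 := by
  obtain ⟨b, hb⟩ := exists_notMem_range_subschemeι t
  obtain ⟨b', hb'⟩ := exists_notMem_range_map _ (Fin 1) hb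
  have h := (coheight_add_one_le_of_isClosedImmersion _ hb' y).trans (coheight_affineSpace_P3_le _)
  exact (ENat.add_le_add_iff_right (by simp)).1 h

theorem inclusion_comp_subschemeι {s s' : Set S} (h : s ⊆ s') :
    inclusion h ≫ (idealSheaf s).subschemeι = (idealSheaf s').subschemeι :=
  Scheme.IdealSheafData.inclusion_subschemeι _

instance {s s' : Set S} (h : s ⊆ s') : IsClosedImmersion (inclusion h) := by
  have : IsClosedImmersion (inclusion h ≫ (idealSheaf s).subschemeι) := by
    rw [inclusion_comp_subschemeι]; infer_instance
  exact IsClosedImmersion.of_comp _ (idealSheaf s).subschemeι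

theorem inclusion_pointOn {s s' : Set S} (h : s ⊆ s') (a : Fin 4 → ℂ) (ha : a ≠ 0)
    (hs : ∀ G ∈ s', evalLine a G = 0) :
    inclusion h (pointOn a ha hs) = pointOn a ha fun G hG ↦ hs G (h hG) := by
  apply (idealSheaf s).subschemeι.isClosedEmbedding.injective
  rw [← Scheme.Hom.comp_apply, inclusion_comp_subschemeι, subschemeι_pointOn, subschemeι_pointOn]

theorem exists_notMem_range_inclusion {t : ℂ} {i : Fin 4} (hi : i = 3 ∨ i = 0)
    (h : ({F t} : Set S) ⊆ {F t, X i}) : ∃ x : surface t, x ∉ Set.range (inclusion h) := by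
  -- The point (1:0:-1:1) lies on every X_t, because x₁ = 0 and x₂x₀⁴ + x₃⁵ = 0, and it avoids both
  -- x₀ = 0 and x₃ = 0.
  have ha : (![1, 0, -1, 1] : Fin 4 → ℂ) ≠ 0 := fun h ↦ by simpa using congrFun h 0
  refine ⟨pointOn ![1, 0, -1, 1] ha (by simp [evalLine, F]; ring), ?_⟩
  rintro ⟨z, hz⟩
  have hz' := congrArg (idealSheaf {F t}).subschemeι hz
  rw [← Scheme.Hom.comp_apply, inclusion_comp_subschemeι, subschemeι_pointOn] at hz'
  have := mem_pointPrime_of_mem (s := {F t, X i}) (G := X i) (by simp) z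
  rw [hz', mem_pointPrime_point] at this
  rcases hi with rfl | rfl <;> simp [evalLine] at this

section

variable {s : Set S}

theorem X_mem_pointPrime_P (hs : ∀ G ∈ s, evalLine ![0, 1, 0, 0] G = 0) (k : Fin 4) (hk : k ≠ 1) :
    (X k : S) ∈ pointPrime ((idealSheaf s).subschemeι (P hs)) := by
  rw [P, subschemeι_pointOn, mem_pointPrime_point]
  fin_cases k <;> simp_all [evalLine]

theorem X_mem_pointPrime_Q (hs : ∀ G ∈ s, evalLine ![0, 0, 1, 0] G = 0) (k : Fin 4) (hk : k ≠ 2) :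
    (X k : S) ∈ pointPrime ((idealSheaf s).subschemeι (Q hs)) := by
  rw [Q, subschemeι_pointOn, mem_pointPrime_point]
  fin_cases k <;> simp_all [evalLine]

theorem X_one_notMem_genericPoint [IsIntegral (variety s)]
    (hs : ∀ G ∈ s, evalLine ![0, 1, 0, 0] G = 0) :
    (X 1 : S) ∉ pointPrime ((idealSheaf s).subschemeι (genericPoint (variety s))) :=
  X_notMem_genericPoint _ (X_notMem_of_forall_ne (X_mem_pointPrime_P hs))

theorem X_two_notMem_genericPoint [IsIntegral (variety s)]
    (hs : ∀ G ∈ s, evalLine ![0, 0, 1, 0] G = 0) :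
    (X 2 : S) ∉ pointPrime ((idealSheaf s).subschemeι (genericPoint (variety s))) :=
  X_notMem_genericPoint _ (X_notMem_of_forall_ne (X_mem_pointPrime_Q hs))

theorem P_ne_genericPoint [IsIntegral (variety s)]
    (hP : ∀ G ∈ s, evalLine ![0, 1, 0, 0] G = 0) (hQ : ∀ G ∈ s, evalLine ![0, 0, 1, 0] G = 0) :
    (P hP : variety s) ≠ genericPoint (variety s) := fun h ↦
  X_two_notMem_genericPoint hQ (h ▸ X_mem_pointPrime_P hP 2 (by decide))

theorem Q_ne_genericPoint [IsIntegral (variety s)]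
    (hP : ∀ G ∈ s, evalLine ![0, 1, 0, 0] G = 0) (hQ : ∀ G ∈ s, evalLine ![0, 0, 1, 0] G = 0) :
    (Q hQ : variety s) ≠ genericPoint (variety s) := fun h ↦
  X_one_notMem_genericPoint hP (h ▸ X_mem_pointPrime_Q hQ 1 (by decide))

end

/-! ### Codimensions and admissibility on X_t, and the final cycle -/

section

variable {t : ℂ} {i : Fin 4} [IsIntegral (variety {F t, X i})]

/-- The curve is a proper closed subset of X_t, whose points have codimension at most 2. -/
theorem coheight_curve_eq_one (hi : i = 3 ∨ i = 0) {z : variety {F t, X i}}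
    (hz : z ≠ genericPoint (variety {F t, X i})) : Order.coheight z = 1 := by
  refine le_antisymm ?_ (one_le_coheight hz)
  obtain ⟨b, hb⟩ := exists_notMem_range_inclusion (t := t) hi (by simp)
  have h := (coheight_add_one_le_of_isClosedImmersion _ hb z).trans (coheight_surface_le _ _)
  rw [show (2 : ℕ∞) = 1 + 1 by norm_num] at h
  exact (ENat.add_le_add_iff_right (by simp)).1 h

theorem two_le_coheight_inclusion (hi : i = 3 ∨ i = 0) {z : variety {F t, X i}}
    (hz : z ≠ genericPoint (variety {F t, X i})) (h : ({F t} : Set S) ⊆ {F t, X i}) :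
    2 ≤ Order.coheight (inclusion h z) := by
  obtain ⟨b, hb⟩ := exists_notMem_range_inclusion (t := t) hi h
  have h := coheight_add_one_le_of_isClosedImmersion _ hb z
  rwa [coheight_curve_eq_one hi hz, show (1 + 1 : ℕ∞) = 2 by norm_num] at h

theorem isAdmissible_graph (hi : i = 3 ∨ i = 0) (hs : ({F t} : Set S) ⊆ {F t, X i})
    {f : (variety {F t, X i}).functionField} (hf : f ≠ 0) {P Q : variety {F t, X i}} {n : ℕ}
    (h : HasZeroPole f P Q n) (hn : n ≠ 0) (hP : P ≠ genericPoint (variety {F t, X i}))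
    (hQ : Q ≠ genericPoint (variety {F t, X i})) :
    IsAdmissible (surface t) 2 1 (graphPoint (inclusion hs) f) := by
  obtain ⟨b, hb⟩ := exists_notMem_range_inclusion (t := t) hi hs
  exact h.isAdmissible_graphPoint _ hn
    (h.coheight_graphPoint _ hn hf hP hb (coheight_affineSpace_surface_le t))
    (two_le_coheight_inclusion hi hP hs) (two_le_coheight_inclusion hi hQ hs)

end

theorem exists_hasZeroPole_Z₁ (t : ℂ) :
    ∃ f : (Z₁ t).functionFieldˣ, HasZeroPole (f : (Z₁ t).functionField) (P₁ t) (Q₁ t) 52 := by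
  have hη {G : S} (hG : G ∈ ({F t, X 3} : Set S)) :=
    mem_pointPrime_of_mem hG (genericPoint (Z₁ t))
  have h1 := X_one_notMem_genericPoint (s := {F t, X 3}) (by simp [evalLine, F])
  have h2 := X_two_notMem_genericPoint (s := {F t, X 3}) (by simp [evalLine, F])
  have h0 : (X 0 : S) ∉ pointPrime ((idealSheaf {F t, X 3}).subschemeι (genericPoint (Z₁ t))) :=
    fun h0 ↦ (X_mem_or_of_F_mem (t := t) (hη (by simp)) h0 (hη (by simp))).elim h1 h2
  exact ⟨Units.mk0 _ (pow_ne_zero 4 (mul_ne_zero (pow_ne_zero 3 (ratio_ne_zero _ h1 h0))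
      (ratio_ne_zero _ h1 h2))),
    hasZeroPole_of_X_three_mem (t := t) _ (hη (by simp)) (hη (by simp)) h1 (X_mem_pointPrime_P _)
      (X_mem_pointPrime_Q _)⟩

theorem exists_hasZeroPole_Z₂ (t : ℂ) :
    ∃ f : (Z₂ t).functionFieldˣ, HasZeroPole (f : (Z₂ t).functionField) (P₂ t) (Q₂ t) 52 := by
  have hη {G : S} (hG : G ∈ ({F t, X 0} : Set S)) :=
    mem_pointPrime_of_mem hG (genericPoint (Z₂ t))
  have h1 := X_one_notMem_genericPoint (s := {F t, X 0}) (by simp [evalLine, F])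
  have h2 := X_two_notMem_genericPoint (s := {F t, X 0}) (by simp [evalLine, F])
  have h3 : (X 3 : S) ∉ pointPrime ((idealSheaf {F t, X 0}).subschemeι (genericPoint (Z₂ t))) :=
    fun h3 ↦ (X_mem_or_of_F_mem (t := t) (hη (by simp)) (hη (by simp)) h3).elim h1 h2
  exact ⟨Units.mk0 _ (pow_ne_zero 13 (ratio_ne_zero _ h1 h3)),
    hasZeroPole_of_X_zero_mem (t := t) _ (hη (by simp)) (hη (by simp)) h1 (X_mem_pointPrime_P _)
      (X_mem_pointPrime_Q _)⟩

theorem ι₁_P₁ (t : ℂ) : ι₁ t (P₁ t) = PX t := inclusion_pointOn _ _ _ (by simp [evalLine, F])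

theorem ι₁_Q₁ (t : ℂ) : ι₁ t (Q₁ t) = QX t := inclusion_pointOn _ _ _ (by simp [evalLine, F])

theorem ι₂_P₂ (t : ℂ) : ι₂ t (P₂ t) = PX t := inclusion_pointOn _ _ _ (by simp [evalLine, F])

theorem ι₂_Q₂ (t : ℂ) : ι₂ t (Q₂ t) = QX t := inclusion_pointOn _ _ _ (by simp [evalLine, F])

instance (t : ℂ) : IsClosedImmersion (ι₁ t) := inferInstanceAs (IsClosedImmersion (inclusion _))

instance (t : ℂ) : IsClosedImmersion (ι₂ t) := inferInstanceAs (IsClosedImmersion (inclusion _))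

theorem graph_mem_chains {Z X : Scheme.{0}} [IsIntegral Z] (ι : Z ⟶ X) (f : Z.functionFieldˣ)
    (h : IsAdmissible X 2 1 (graphPoint ι f)) : graph ι f ∈ chains X 2 1 := by
  rw [graph]
  split_ifs
  · exact zero_mem _
  · intro w hw
    obtain rfl := Finset.mem_singleton.1 (Finsupp.support_single_subset hw)
    exact h

end ShiodaQuintic

end

theorem corollary6p6 (t : ℂ) :
    RationallyEquivalent (Finsupp.single (P₁ t) 52) (Finsupp.single (Q₁ t) 52) ∧
    RationallyEquivalent (Finsupp.single (P₂ t) 52) (Finsupp.single (Q₂ t) 52) ∧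
    ∃ (f₁ : (Z₁ t).functionFieldˣ) (f₂ : (Z₂ t).functionFieldˣ) (D₁ : Z₁ t →₀ ℤ) (D₂ : Z₂ t →₀ ℤ),
      HasDivisor f₁ D₁ ∧ HasDivisor f₂ D₂ ∧
      D₁.mapDomain (ι₁ t) = Finsupp.single (PX t) 52 - Finsupp.single (QX t) 52 ∧
      D₂.mapDomain (ι₂ t) = -(Finsupp.single (PX t) 52 - Finsupp.single (QX t) 52) ∧
      ∃ Z : HigherChow (surface t) 2 1, Represents (graph (ι₁ t) f₁ + graph (ι₂ t) f₂) Z := by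
  obtain ⟨f₁, h₁⟩ := exists_hasZeroPole_Z₁ t
  obtain ⟨f₂, h₂⟩ := exists_hasZeroPole_Z₂ t
  have hP₁ : P₁ t ≠ genericPoint (Z₁ t) := P_ne_genericPoint _ (by simp [evalLine, F])
  have hQ₁ : Q₁ t ≠ genericPoint (Z₁ t) := Q_ne_genericPoint (by simp [evalLine, F]) _
  have hP₂ : P₂ t ≠ genericPoint (Z₂ t) := P_ne_genericPoint _ (by simp [evalLine, F])
  have hQ₂ : Q₂ t ≠ genericPoint (Z₂ t) := Q_ne_genericPoint (by simp [evalLine, F]) _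
  have d₁ := h₁.hasDivisor (by norm_num) (coheight_curve_eq_one (.inl rfl) hP₁)
    (coheight_curve_eq_one (.inl rfl) hQ₁)
  have d₂ := h₂.hasDivisor (by norm_num) (coheight_curve_eq_one (.inr rfl) hP₂)
    (coheight_curve_eq_one (.inr rfl) hQ₂)
  have h₂' : HasZeroPole ((f₂⁻¹ : (Z₂ t).functionFieldˣ) : (Z₂ t).functionField)
      (Q₂ t) (P₂ t) 52 := by
    rw [Units.val_inv_eq_inv_val]
    exact h₂.inv
  have d₂' := h₂'.hasDivisor (by norm_num) (coheight_curve_eq_one (.inr rfl) hQ₂)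
    (coheight_curve_eq_one (.inr rfl) hP₂)
  -- `f₂` has the same divisor 52P - 52Q as `f₁`, which is what rational equivalence needs; its
  -- inverse, with P and Q exchanged, makes the boundaries cancel.
  refine ⟨⟨f₁, d₁⟩, ⟨f₂, d₂⟩, f₁, f₂⁻¹, _, _, d₁, d₂', ?_, ?_, ?_⟩
  · rw [Finsupp.mapDomain_sub, Finsupp.mapDomain_single, Finsupp.mapDomain_single, ι₁_P₁, ι₁_Q₁]
    rfl
  · rw [Finsupp.mapDomain_sub, Finsupp.mapDomain_single, Finsupp.mapDomain_single, ι₂_P₂, ι₂_Q₂,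
      neg_sub]
    rfl
  · have hc : graph (ι₁ t) f₁ + graph (ι₂ t) f₂⁻¹ ∈ cycles (surface t) 2 1 := by
      refine ⟨add_mem (graph_mem_chains _ _ ?_) (graph_mem_chains _ _ ?_), ?_⟩
      · exact isAdmissible_graph (.inl rfl) _ f₁.ne_zero h₁ (by norm_num) hP₁ hQ₁
      · exact isAdmissible_graph (.inr rfl) _ (Units.ne_zero _) h₂' (by norm_num) hQ₂ hP₂
      · change boundary (surface t) 2 0 _ = 0
        rw [map_add, h₁.boundary_graph _ (by norm_num), h₂'.boundary_graph _ (by norm_num),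
          ι₁_P₁, ι₁_Q₁, ι₂_P₂, ι₂_Q₂]
        funext y
        simp only [Pi.add_apply, Pi.zero_apply]
        split_ifs <;> ring
    exact ⟨_, hc, rfl⟩
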